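/- Let $A=(b_i)_{i\ge 1}$ be a sequence of integers $b_i\ge 2$. Every $x\in[0,1]$ has an $A$-Cantor series expansion $x=\sum_{i\ge1}\epsilon_i(x)/(b_1\cdots b_i)$ with digits $\epsilon_i(x)\in\{0,\dots,b_i-1\}$ (for $x<1$ with two expansions take the terminating one). Assume that for every $k$ the limit $d_k=\lim_{N\to\infty}\frac1N\#\{i\le N: b_i=k\}$ exists and that $\sum_{n\ge2}d_n=1$. Let $\alpha=(\alpha_j)_{j\ge0}$ be a stochastic vector ($\alpha_j\ge0$, $\sum_j\alpha_j=1$). Put $$J_A(\alpha)=\Big\{x\in[0,1]:\ \lim_{N\to\infty}\tfrac1N\#\{i\le N:\epsilon_i(x)=j\}=\alpha_j\ \text{ for all } j\ge0\Big\}.$$ Let $\pi$ be the set of all $P=(p_{n,j})_{n\ge2,\,0\le j<n}$ with $p_{n,j}\ge0$ and $\sum_{j=0}^{n-1}p_{n,j}=1$ for every $n\ge 2$ (with $p_{n,j}=0$ for $j\ge n$), let $\pi(\alpha)=\{P\in\pi:\ \sum_{n\ge2}d_np_{n,j}=\alpha_j\ \text{for all } j\ge 0\}$, and for $P\in\pi$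 put $$J_A(P)=\Big\{x\in[0,1]:\ \lim_{N\to\infty}\tfrac1N\#\{i\le N: b_i=n,\ \epsilon_i(x)=j\}=d_np_{n,j}\ \text{ for all } n\ge 2,\ 0\le j<n\Big\},$$ $$Q(P)=\frac{-\sum_{n\ge2}d_n\sum_{j=0}^{n-1}p_{n,j}\log p_{n,j}}{\sum_{n\ge2}d_n\log n}\qquad(0\log 0=0).$$ Put $j_0=\min\{j:\alpha_j\ne0\}$, $d_1=0$, and $$A_n=\sum_{j=j_0}^{n-1}\alpha_j-\sum_{k=j_0+1}^{n-1}d_k,\qquad r_n=\frac1{A_n}\prod_{k=j_0+1}^{n-1}\Big(1-\frac{d_k}{A_k}\Big),\qquad t_j=\frac{\alpha_j}{\prod_{k=j_0+1}^{j}\big(1-\frac{d_k}{A_k}\big)},$$ where a factor $1-d_k/A_k$ with $A_k=0$ is read as $1$. Let $P^\alpha=(p^\alpha_{n,j})$ be the matrix with $p^\alpha_{n,j}=r_nt_j$ for $j_0\le j<n$, that is, after cancelling the common factors of $r_n$ and $t_j$, $$p^\alpha_{n,j}=\frac{\alpha_j}{A_n}\prod_{k=j+1}^{n-1}\Big(1-\frac{d_k}{A_k}\Big)\qquad(n>j_0,\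 A_n\ne0,\ j_0\le j<n)$$ (the cancelled form is the definition also when the denominator of $t_j$ vanishes), with $p^\alpha_{n,j}=0$ for $n>j_0$, $A_n\neq 0$, $j<j_0$, and with uniform rows $p^\alpha_{n,j}=1/n$, $0\le j<n$, if $n\le j_0$ or $A_n=0$. Assume that $\pi(\alpha)\ne\emptyset$. Then: 1. $P^\alpha\in\pi(\alpha)$; moreover $p^\alpha_{n,j}=r_nt_j$ whenever $j_0\le j<n$, $A_n\ne0$ and the denominator of $t_j$ is non-zero; and $d_n=0$ for every $n$ with $n\le j_0$ or $A_n=0$. 2. $J_A(P^\alpha)\subseteq J_A(\alpha)$ and $\dim_HJ_A(P^\alpha)=\dim_HJ_A(\alpha)$. 3. The supremum in $\dim_HJ_A(\alpha)=\sup_{P\in\pi(\alpha)}\dim_HJ_A(P)$ is attained at $P=P^\alpha$. 4. If $\sum_n d_n\log n<\infty$, then also $\sup_{P\in\pi(\alpha)}Q(P)$ is attained at $P=P^\alpha$. If moreover $\frac1N\sum_{i=1}^N\log b_i\to\sum_nd_n\log n$ as $N\to\infty$ (for example, if $A$ is bounded), then $\dim_HJ_A(\alpha)=Q(P^\alpha)=\max_{P\in\pi(\alpha)}Q(P)$.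 -/

import Mathlib

namespace CantorSeries

noncomputable section

/-!
Sequences are indexed from `0`: the base `b i` and the digit `digit b x i` are the
`(i+1)`-st base and the `(i+1)`-st digit.
-/

/-- The digits of `x ∈ [0,1]` in the Cantor series with bases `b 0, b 1, …`. A number in `[0,1)`
with two expansions gets the terminating one; the number `1` gets its only expansion. -/
def digit (b : ℕ → ℕ) (x : ℝ) (i : ℕ) : ℕ :=
  if x = 1 then b i - 1 else ⌊x * (∏ k ∈ Finset.range (i + 1), b k : ℕ)⌋₊ % b i

theorem digit_lt {b : ℕ → ℕ} (hb : ∀ i, 2 ≤ b i) (x : ℝ) (i : ℕ) : digit b x i < b i := by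
  have := hb i
  unfold digit
  split_ifs
  · omega
  · exact Nat.mod_lt _ (by omega)

/-- The digits of `x ∈ [0,1]` do give a Cantor series expansion of `x`. -/
theorem hasSum_digit {b : ℕ → ℕ} (hb : ∀ i, 2 ≤ b i) {x : ℝ} (hx : x ∈ Set.Icc (0 : ℝ) 1) :
    HasSum (fun i => (digit b x i : ℝ) / (∏ k ∈ Finset.range (i + 1), b k : ℕ)) x := by
  have hb0 : ∀ i, (b i : ℝ) ≠ 0 := fun i => by
    have := hb i
    exact_mod_cast (by omega : b i ≠ 0)
  have hpos : ∀ n, (0 : ℝ) < (∏ k ∈ Finset.range n, b k : ℕ) := fun n => by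
    exact_mod_cast Finset.prod_pos fun i _ => by have := hb i; omega
  have hpow : ∀ n, (2 : ℝ) ^ n ≤ (∏ k ∈ Finset.range n, b k : ℕ) := fun n => by
    have : (2 : ℕ) ^ n ≤ ∏ k ∈ Finset.range n, b k := by
      simpa using Finset.pow_card_le_prod (Finset.range n) b 2 (fun i _ => hb i)
    exact_mod_cast this
  have key : ∀ n, x - 1 / (∏ k ∈ Finset.range n, b k : ℕ) ≤
      ∑ i ∈ Finset.range n, (digit b x i : ℝ) / (∏ k ∈ Finset.range (i + 1), b k : ℕ) ∧
      ∑ i ∈ Finset.range n, (digit b x i : ℝ) / (∏ k ∈ Finset.range (i + 1), b k : ℕ) ≤ x := by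
    intro n
    by_cases h1 : x = 1
    · have : ∑ i ∈ Finset.range n, (digit b x i : ℝ) / (∏ k ∈ Finset.range (i + 1), b k : ℕ) =
          1 - 1 / (∏ k ∈ Finset.range n, b k : ℕ) := by
        induction n with
        | zero => simp
        | succ n ih =>
          rw [Finset.sum_range_succ, ih, digit, if_pos h1,
            Nat.cast_sub (by have := hb n; omega), Finset.prod_range_succ]
          have := (hpos n).ne'
          have := hb0 n
          push_cast at *
          field_simp
          ring
      rw [this, h1]
      exact ⟨le_rfl, sub_le_self _ (one_div_nonneg.2 (hpos n).le)⟩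
    · have : ∑ i ∈ Finset.range n, (digit b x i : ℝ) / (∏ k ∈ Finset.range (i + 1), b k : ℕ) =
          (⌊x * (∏ k ∈ Finset.range n, b k : ℕ)⌋₊ : ℝ) / (∏ k ∈ Finset.range n, b k : ℕ) := by
        induction n with
        | zero => simp [Nat.floor_eq_zero.2 (lt_of_le_of_ne hx.2 h1)]
        | succ n ih =>
          have hdiv : ⌊x * (∏ k ∈ Finset.range (n + 1), b k : ℕ)⌋₊ / b n =
              ⌊x * (∏ k ∈ Finset.range n, b k : ℕ)⌋₊ := by
            rw [← Nat.floor_div_natCast]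
            congr 1
            rw [Finset.prod_range_succ]
            have := hb0 n
            push_cast
            field_simp
          have hmod := Nat.div_add_mod ⌊x * (∏ k ∈ Finset.range (n + 1), b k : ℕ)⌋₊ (b n)
          rw [hdiv] at hmod
          rw [Finset.sum_range_succ, ih, digit, if_neg h1]
          have h2 : (b n : ℝ) * (⌊x * (∏ k ∈ Finset.range n, b k : ℕ)⌋₊ : ℝ) +
              ((⌊x * (∏ k ∈ Finset.range (n + 1), b k : ℕ)⌋₊ % b n : ℕ) : ℝ) =
              (⌊x * (∏ k ∈ Finset.range (n + 1), b k : ℕ)⌋₊ : ℝ) := by exact_mod_cast hmod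
          rw [← h2]
          have hp : ((∏ k ∈ Finset.range (n + 1), b k : ℕ) : ℝ) =
              (∏ k ∈ Finset.range n, b k : ℕ) * b n := by
            rw [Finset.prod_range_succ, Nat.cast_mul]
          rw [add_div]
          congr 1
          rw [hp]
          have := (hpos n).ne'
          have := hb0 n
          field_simp
      rw [this]
      have hn : 0 ≤ x * (∏ k ∈ Finset.range n, b k : ℕ) := mul_nonneg hx.1 (hpos n).le
      refine ⟨?_, (div_le_iff₀ (hpos n)).2 (Nat.floor_le hn)⟩
      rw [le_div_iff₀ (hpos n), sub_mul, div_mul_cancel₀ _ (hpos n).ne']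
      linarith [Nat.lt_floor_add_one (x * (∏ k ∈ Finset.range n, b k : ℕ))]
  rw [hasSum_iff_tendsto_nat_of_nonneg (fun i => by positivity)]
  refine tendsto_of_tendsto_of_tendsto_of_le_of_le (g := fun n : ℕ => x - (1 / 2 : ℝ) ^ n)
    (h := fun _ => x) ?_ tendsto_const_nhds (fun n => ?_) (fun n => (key n).2)
  · simpa using (tendsto_const_nhds (x := x)).sub
      (tendsto_pow_atTop_nhds_zero_of_lt_one (r := (1 / 2 : ℝ)) (by norm_num) (by norm_num))
  · refine le_trans ?_ (key n).1
    have h := one_div_le_one_div_of_le (by positivity) (hpow n)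
    simp only [one_div, inv_pow] at h ⊢
    linarith

/-- Number of occurrences of the digit `j` among the first `n` digits of `x`. -/
def digitCount (b : ℕ → ℕ) (x : ℝ) (j n : ℕ) : ℕ :=
  ((Finset.range n).filter fun i => digit b x i = j).card

/-- Number of occurrences of the base `k` among the first `n` bases. -/
def baseCount (b : ℕ → ℕ) (k n : ℕ) : ℕ :=
  ((Finset.range n).filter fun i => b i = k).card

/-- Number of positions among the first `n` where the base is `k` and the digit of `x` is `j`. -/
def jointCount (b : ℕ → ℕ) (x : ℝ) (k j n : ℕ) : ℕ :=
  ((Finset.range n).filter fun i => b i = k ∧ digit b x i = j).card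

/-- `d k` is the (existing) asymptotic frequency of the base `k`, for every `k`. -/
def IsBaseFrequency (b : ℕ → ℕ) (d : ℕ → ℝ) : Prop :=
  ∀ k, Filter.Tendsto (fun n : ℕ => (baseCount b k n : ℝ) / n) Filter.atTop (nhds (d k))

/-- A probability vector indexed by `0, 1, 2, …`. -/
def IsStochastic (α : ℕ → ℝ) : Prop :=
  (∀ j, 0 ≤ α j) ∧ HasSum α 1

/-- `J_A(α)`: the points of `[0,1]` whose digit frequencies exist and are given by `α`. -/
def levelSet (b : ℕ → ℕ) (α : ℕ → ℝ) : Set ℝ :=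
  {x | x ∈ Set.Icc (0 : ℝ) 1 ∧ ∀ j,
    Filter.Tendsto (fun n : ℕ => (digitCount b x j n : ℝ) / n) Filter.atTop (nhds (α j))}

/-- `J_A(P)`: the points of `[0,1]` for which the joint frequency of base `k` and digit `j`
exists and equals `d k * P k j`. -/
def jointLevelSet (b : ℕ → ℕ) (d : ℕ → ℝ) (P : ℕ → ℕ → ℝ) : Set ℝ :=
  {x | x ∈ Set.Icc (0 : ℝ) 1 ∧ ∀ k, 2 ≤ k → ∀ j < k,
    Filter.Tendsto (fun n : ℕ => (jointCount b x k j n : ℝ) / n) Filter.atTop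
      (nhds (d k * P k j))}

/-- `π`: triangular stochastic matrices `(P n j)`, `n ≥ 2`, `0 ≤ j < n`, extended by `0` to
`j ≥ n`. The rows `0` and `1` carry no information. -/
def stochMatrices : Set (ℕ → ℕ → ℝ) :=
  {P | ∀ n, 2 ≤ n → (∀ j, 0 ≤ P n j) ∧ (∀ j, n ≤ j → P n j = 0) ∧
    ∑ j ∈ Finset.range n, P n j = 1}

/-- `π(α)`: the matrices in `π` with `∑ₙ d n * P n j = α j` for every `j`, over `n ≥ 2`. -/
def admissible (d α : ℕ → ℝ) : Set (ℕ → ℕ → ℝ) :=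
  {P | P ∈ stochMatrices ∧ ∀ j, HasSum (fun n => if 2 ≤ n then d n * P n j else 0) (α j)}

/-- The entropy quotient
`(-∑ₙ d n ∑_{j<n} P n j log (P n j)) / ∑ₙ d n log n` of a matrix. -/
def entropyQuotient (d : ℕ → ℝ) (P : ℕ → ℕ → ℝ) : ℝ :=
  (∑' n, if 2 ≤ n then -(d n * ∑ j ∈ Finset.range n, P n j * Real.log (P n j)) else 0) /
    ∑' n, if 2 ≤ n then d n * Real.log n else 0

/-- `j₀`, the least `j` with `α j ≠ 0`. -/
def jMin (α : ℕ → ℝ) : ℕ := sInf {j | α j ≠ 0}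

/-- `A_n = ∑_{j=j₀}^{n-1} α_j - ∑_{k=j₀+1}^{n-1} d_k`. -/
def massA (d α : ℕ → ℝ) (n : ℕ) : ℝ :=
  ∑ j ∈ Finset.Ico (jMin α) n, α j - ∑ k ∈ Finset.Ico (jMin α + 1) n, d k

/-- The factor `1 - d_k / A_k`. -/
def factor (d α : ℕ → ℝ) (k : ℕ) : ℝ := 1 - d k / massA d α k

/-- `r_n = (1 / A_n) ∏_{k=j₀+1}^{n-1} (1 - d_k / A_k)`. -/
def rSeq (d α : ℕ → ℝ) (n : ℕ) : ℝ :=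
  1 / massA d α n * ∏ k ∈ Finset.Ico (jMin α + 1) n, factor d α k

/-- `t_j = α_j / ∏_{k=j₀+1}^{j} (1 - d_k / A_k)`. -/
def tSeq (d α : ℕ → ℝ) (j : ℕ) : ℝ :=
  α j / ∏ k ∈ Finset.Icc (jMin α + 1) j, factor d α k

/-- The matrix `P^α`. For `n > j₀`, `A_n ≠ 0` and `j₀ ≤ j < n` the entry is `r_n t_j` with the
common factors of `r_n` and `t_j` cancelled,
`(α_j / A_n) ∏_{k=j+1}^{n-1} (1 - d_k / A_k)`; it is `0` for the other `j`. The cancelled form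
also makes sense if a factor in the denominator of `t_j` vanishes. If `n ≤ j₀` or `A_n = 0`,
the row is uniform. -/
def optMatrix (d α : ℕ → ℝ) (n j : ℕ) : ℝ :=
  if jMin α < n ∧ massA d α n ≠ 0 then
    if jMin α ≤ j ∧ j < n then
      α j / massA d α n * ∏ k ∈ Finset.Ico (j + 1) n, factor d α k
    else 0
  else if j < n then 1 / (n : ℝ) else 0

end

end CantorSeries

/-!
The entries of `P^α` have the product form `p n j = r n * t j`, so `-log (p n j)` is a function of
the digit plus a function of the base, and its mean under any `P ∈ π(α)` depends only on the
marginals `α` and `d`. Hence, by Gibbs' inequality, `P^α` maximizes the entropy over `π(α)`. For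
the same reason the product weights given by the rows of `P^α`, mixed with a little of the uniform
law, give comparable mass to all cylinders that meet `J_A(α)`, whatever the joint frequencies of
bases and digits are; this bounds the dimension of `J_A(α)` from above. Conversely, independent
digits drawn from the rows of `P`, and uniformly for bases above a slowly growing threshold, lie in
`J_A(P)` almost surely, and the mass distribution principle bounds the dimension of `J_A(P)` from
below. Both bounds compare the entropy with the mean logarithm of the bases along the same
positions. If the mean logarithm tends to infinity, all the dimensions are `1`; otherwise
`∑ n, d n * log n` is finite.
-/

namespace CantorSeries

open Filter Topology MeasureTheory ProbabilityTheory Finset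

/-- Number of positions `i < N` at which the sequence `u` takes the value `a`. The counting
functions of bases, digits and pairs (base, digit) are all of this form. -/
def occurrences {ι : Type*} [DecidableEq ι] (u : ℕ → ι) (a : ι) (N : ℕ) : ℕ :=
  ((range N).filter fun i => u i = a).card

/-- The value `a` has asymptotic frequency `θ` in the sequence `u`. -/
def HasFrequency {ι : Type*} [DecidableEq ι] (u : ℕ → ι) (a : ι) (θ : ℝ) : Prop :=
  Tendsto (fun N : ℕ => (occurrences u a N : ℝ) / N) atTop (𝓝 θ)

section Frequency

variable {ι κ : Type*} [DecidableEq ι] [DecidableEq κ]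

theorem HasFrequency.nonneg {u : ℕ → ι} {a : ι} {θ : ℝ} (h : HasFrequency u a θ) : 0 ≤ θ :=
  ge_of_tendsto' h fun _ => by positivity

theorem hasFrequency_zero {u : ℕ → ι} {a : ι} (h : ∀ i, u i ≠ a) : HasFrequency u a 0 := by
  simp [HasFrequency, occurrences, h]

theorem tendsto_average_of_hasFrequency {u : ℕ → ι} {s : Finset ι} {θ : ι → ℝ}
    (h : ∀ a ∈ s, HasFrequency u a (θ a)) (g : ι → ℝ) :
    Tendsto (fun N : ℕ => (∑ i ∈ range N, if u i ∈ s then g (u i) else 0) / (N : ℝ)) atTop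
      (𝓝 (∑ a ∈ s, θ a * g a)) := by
  refine (tendsto_finsetSum s fun a ha => (h a ha).mul_const (g a)).congr fun N => ?_
  have indicator_eq_sum (i : ℕ) :
      (if u i ∈ s then g (u i) else 0) = ∑ a ∈ s, if u i = a then g a else 0 := by
    rw [Finset.sum_ite_eq]
  simp_rw [indicator_eq_sum]
  rw [Finset.sum_comm, Finset.sum_div]
  refine Finset.sum_congr rfl fun a _ => ?_
  rw [← Finset.sum_filter, Finset.sum_const, nsmul_eq_mul, occurrences]
  ring

theorem HasFrequency.of_pair {u : ℕ → ι} {v : ℕ → κ} {d θ : ι → ℝ} {j : κ} {a : ℝ}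
    (hu : ∀ k, HasFrequency u k (d k)) (hd : HasSum d 1)
    (huv : ∀ k, HasFrequency (fun i => (u i, v i)) (k, j) (θ k)) (hθ : HasSum θ a) :
    HasFrequency v j a := by
  let inner (s : Finset ι) (N : ℕ) : ℝ :=
    (∑ i ∈ range N, if u i ∈ s ∧ v i = j then (1 : ℝ) else 0) / N
  let base (s : Finset ι) (N : ℕ) : ℝ := (∑ i ∈ range N, if u i ∈ s then (1 : ℝ) else 0) / N
  have tendsto_inner (s : Finset ι) : Tendsto (inner s) atTop (𝓝 (∑ k ∈ s, θ k)) := by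
    have h := tendsto_average_of_hasFrequency (u := fun i => (u i, v i)) (s := s ×ˢ {j})
      (θ := fun p => θ p.1) (by rintro ⟨k, j'⟩ hk; simp_all) fun _ => 1
    simpa only [Finset.mem_product, Finset.mem_singleton, mul_one, Finset.sum_product,
      Finset.sum_singleton] using h
  have tendsto_base (s : Finset ι) : Tendsto (base s) atTop (𝓝 (∑ k ∈ s, d k)) := by
    simpa only [mul_one] using
      tendsto_average_of_hasFrequency (fun k (_ : k ∈ s) => hu k) fun _ => 1
  have occurrences_eq (N : ℕ) :
      (occurrences v j N : ℝ) = ∑ i ∈ range N, if v i = j then (1 : ℝ) else 0 := by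
    simp [occurrences]
  have inner_le (s : Finset ι) (N : ℕ) : inner s N ≤ occurrences v j N / N := by
    rw [occurrences_eq]
    refine div_le_div_of_nonneg_right (Finset.sum_le_sum fun i _ => ?_) N.cast_nonneg
    split_ifs <;> simp_all
  have le_inner_add (s : Finset ι) (N : ℕ) :
      occurrences v j N / N ≤ inner s N + (1 - base s N) := by
    suffices h : occurrences v j N / N + base s N - inner s N ≤ 1 by linarith
    rw [occurrences_eq, ← add_div, ← sub_div, ← Finset.sum_add_distrib, ← Finset.sum_sub_distrib]
    refine div_le_one_of_le₀ ((Finset.sum_le_card_nsmul _ _ 1 fun i _ => ?_).trans (by simp))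
      N.cast_nonneg
    split_ifs <;> simp_all
  refine tendsto_order.2 ⟨fun c hc => ?_, fun c hc => ?_⟩
  · obtain ⟨s, hs⟩ := (hθ.eventually (lt_mem_nhds hc)).exists
    filter_upwards [(tendsto_inner s).eventually (lt_mem_nhds hs)] with N hN
    exact hN.trans_le (inner_le s N)
  · have hlim : Tendsto (fun s => ∑ k ∈ s, θ k + (1 - ∑ k ∈ s, d k)) atTop (𝓝 a) := by
      simpa using Tendsto.add hθ ((tendsto_const_nhds (x := (1 : ℝ))).sub hd)
    obtain ⟨s, hs⟩ := (hlim.eventually (gt_mem_nhds hc)).exists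
    filter_upwards [((tendsto_inner s).add (tendsto_const_nhds.sub (tendsto_base s))).eventually
      (gt_mem_nhds hs)] with N hN
    exact (le_inner_add s N).trans_lt hN

end Frequency

/-- A probability distribution on the possible bases `2, 3, …`, such as the limit frequencies of
the bases. -/
structure IsBaseDistribution (d : ℕ → ℝ) : Prop where
  nonneg : ∀ n, 0 ≤ d n
  eq_zero_of_lt_two : ∀ n < 2, d n = 0
  hasSum : HasSum d 1

theorem IsBaseFrequency.isBaseDistribution {b : ℕ → ℕ} (hb : ∀ i, 2 ≤ b i) {d : ℕ → ℝ}
    (hfreq : IsBaseFrequency b d) (hd : HasSum d 1) : IsBaseDistribution d where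
  nonneg n := HasFrequency.nonneg (hfreq n)
  eq_zero_of_lt_two n hn :=
    tendsto_nhds_unique (hfreq n) (hasFrequency_zero fun i => (hn.trans_le (hb i)).ne')
  hasSum := hd

theorem IsBaseDistribution.ite_two_le {d : ℕ → ℝ} (hd : IsBaseDistribution d) (g : ℕ → ℝ) :
    (fun n => if 2 ≤ n then d n * g n else 0) = fun n => d n * g n := by
  ext n
  split_ifs with h
  · rfl
  · rw [hd.eq_zero_of_lt_two n (not_le.1 h), zero_mul]

section Admissible

variable {d α : ℕ → ℝ} {P : ℕ → ℕ → ℝ}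

theorem sum_range_row {n k : ℕ} (hP : P ∈ stochMatrices) (hn : 2 ≤ n) (hk : n ≤ k) :
    ∑ j ∈ range k, P n j = 1 := by
  rw [← (hP n hn).2.2]
  exact (Finset.sum_subset (range_subset_range.2 hk)
    fun j _ hj => (hP n hn).2.1 j (by simpa using hj)).symm

theorem mul_entry_nonneg (hd : IsBaseDistribution d) (hP : P ∈ stochMatrices) (n j : ℕ) :
    0 ≤ d n * P n j := by
  rcases lt_or_ge n 2 with hn | hn
  · simp [hd.eq_zero_of_lt_two n hn]
  · exact mul_nonneg (hd.nonneg n) ((hP n hn).1 j)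

theorem hasSum_mul_entry (hd : IsBaseDistribution d) (hP : P ∈ admissible d α) (j : ℕ) :
    HasSum (fun n => d n * P n j) (α j) :=
  hd.ite_two_le (P · j) ▸ hP.2 j

theorem hasFrequency_digit_of_pair {b e : ℕ → ℕ} (hb : ∀ i, 2 ≤ b i) (he : ∀ i, e i < b i)
    (hfreq : IsBaseFrequency b d) (hd : HasSum d 1) (hP : P ∈ admissible d α)
    (hpair : ∀ k, 2 ≤ k → ∀ j < k, HasFrequency (fun i => (b i, e i)) (k, j) (d k * P k j))
    (j : ℕ) : HasFrequency e j (α j) := by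
  refine HasFrequency.of_pair hfreq hd (fun k => ?_) (hP.2 j)
  by_cases hk : 2 ≤ k ∧ j < k
  · simpa [hk.1] using hpair k hk.1 j hk.2
  · have hzero : (if 2 ≤ k then d k * P k j else 0) = 0 := by
      split_ifs with h
      · rw [(hP.1 k h).2.1 j (by lia), mul_zero]
      · rfl
    rw [hzero]
    refine hasFrequency_zero fun i h => hk ?_
    obtain ⟨rfl, rfl⟩ := Prod.mk.inj h
    exact ⟨hb i, he i⟩

theorem jointCount_eq_occurrences (b : ℕ → ℕ) (x : ℝ) (k j N : ℕ) :
    jointCount b x k j N = occurrences (fun i => (b i, digit b x i)) (k, j) N := by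
  simp only [jointCount, occurrences, Prod.mk.injEq]

theorem jointLevelSet_subset_levelSet {b : ℕ → ℕ} (hb : ∀ i, 2 ≤ b i)
    (hfreq : IsBaseFrequency b d) (hd : HasSum d 1) (hP : P ∈ admissible d α) :
    jointLevelSet b d P ⊆ levelSet b α := fun x hx =>
  ⟨hx.1, hasFrequency_digit_of_pair hb (digit_lt hb x) hfreq hd hP fun k hk j hj => by
    simpa only [HasFrequency, ← jointCount_eq_occurrences] using hx.2 k hk j hj⟩

theorem sum_range_add_le (hd : IsBaseDistribution d) (hP : P ∈ admissible d α) {k m : ℕ}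
    (hkm : k < m) :
    ∑ n ∈ range (k + 1), d n + d m * ∑ j ∈ range k, P m j ≤ ∑ j ∈ range k, α j := by
  have hsum : HasSum (fun n => d n * ∑ j ∈ range k, P n j) (∑ j ∈ range k, α j) := by
    simpa only [Finset.mul_sum] using hasSum_sum fun j _ => hasSum_mul_entry hd hP j
  have hm : m ∉ range (k + 1) := by simpa using hkm
  have hfull : ∑ n ∈ range (k + 1), d n = ∑ n ∈ range (k + 1), d n * ∑ j ∈ range k, P n j := by
    refine Finset.sum_congr rfl fun n hn => ?_
    rcases lt_or_ge n 2 with h2 | h2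
    · simp [hd.eq_zero_of_lt_two n h2]
    · rw [sum_range_row hP.1 h2 (Nat.lt_succ_iff.1 (Finset.mem_range.1 hn)), mul_one]
  rw [hfull, add_comm, ← Finset.sum_insert (f := fun n => d n * ∑ j ∈ range k, P n j) hm]
  refine sum_le_hasSum _ (fun n _ => ?_) hsum
  rw [Finset.mul_sum]
  exact Finset.sum_nonneg fun j _ => mul_entry_nonneg hd hP.1 n j

theorem sum_range_succ_le (hd : IsBaseDistribution d) (hne : (admissible d α).Nonempty) (k : ℕ) :
    ∑ n ∈ range (k + 1), d n ≤ ∑ j ∈ range k, α j := by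
  obtain ⟨P, hP⟩ := hne
  refine le_trans (le_add_of_nonneg_right ?_) (sum_range_add_le hd hP k.lt_succ_self)
  rw [Finset.mul_sum]
  exact Finset.sum_nonneg fun j _ => mul_entry_nonneg hd hP.1 _ j

end Admissible

section OptMatrix

variable {d α : ℕ → ℝ}

theorem eq_zero_of_lt_jMin {j : ℕ} (hj : j < jMin α) : α j = 0 :=
  not_not.1 (Nat.notMem_of_lt_sInf hj)

theorem eq_zero_of_le_jMin (hd : IsBaseDistribution d) (hne : (admissible d α).Nonempty) {n : ℕ}
    (hn : n ≤ jMin α) : d n = 0 := by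
  refine le_antisymm ?_ (hd.nonneg n)
  calc d n ≤ ∑ k ∈ range (jMin α + 1), d k :=
        Finset.single_le_sum (fun k _ => hd.nonneg k) (Finset.mem_range.2 (Nat.lt_succ_of_le hn))
    _ ≤ ∑ j ∈ range (jMin α), α j := sum_range_succ_le hd hne _
    _ = 0 := Finset.sum_eq_zero fun j hj => eq_zero_of_lt_jMin (Finset.mem_range.1 hj)

theorem massA_eq (hd : IsBaseDistribution d) (hne : (admissible d α).Nonempty) (n : ℕ) :
    massA d α n = ∑ j ∈ range n, α j - ∑ k ∈ range n, d k := by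
  unfold massA
  congr 1
  · refine Finset.sum_subset (fun j hj => ?_) fun j hj hj' => eq_zero_of_lt_jMin ?_ <;>
      simp only [Finset.mem_Ico, Finset.mem_range] at * <;> lia
  · refine Finset.sum_subset (fun k hk => ?_) fun k hk hk' => eq_zero_of_le_jMin hd hne ?_ <;>
      simp only [Finset.mem_Ico, Finset.mem_range] at * <;> lia

theorem le_massA (hd : IsBaseDistribution d) (hne : (admissible d α).Nonempty) (n : ℕ) :
    d n ≤ massA d α n := by
  have h := sum_range_succ_le hd hne n
  rw [Finset.sum_range_succ] at h
  rw [massA_eq hd hne]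
  linarith

theorem massA_nonneg (hd : IsBaseDistribution d) (hne : (admissible d α).Nonempty) (n : ℕ) :
    0 ≤ massA d α n :=
  (hd.nonneg n).trans (le_massA hd hne n)

theorem massA_succ (hd : IsBaseDistribution d) (hne : (admissible d α).Nonempty) (n : ℕ) :
    massA d α (n + 1) = massA d α n - d n + α n := by
  rw [massA_eq hd hne, massA_eq hd hne, Finset.sum_range_succ, Finset.sum_range_succ]
  ring

theorem eq_zero_of_massA_eq_zero (hd : IsBaseDistribution d) (hne : (admissible d α).Nonempty)
    {n : ℕ} (h : massA d α n = 0) : d n = 0 :=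
  le_antisymm (h ▸ le_massA hd hne n) (hd.nonneg n)

theorem massA_pos (hd : IsBaseDistribution d) (hne : (admissible d α).Nonempty) {n : ℕ}
    (h : d n ≠ 0) : 0 < massA d α n :=
  (massA_nonneg hd hne n).lt_of_ne' fun h0 => h (eq_zero_of_massA_eq_zero hd hne h0)

theorem massA_mul_factor (hd : IsBaseDistribution d) (hne : (admissible d α).Nonempty) (n : ℕ) :
    massA d α n * factor d α n = massA d α n - d n := by
  unfold factor
  by_cases h : massA d α n = 0
  · simp [h, eq_zero_of_massA_eq_zero hd hne h]
  · field_simp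

theorem factor_nonneg (hd : IsBaseDistribution d) (hne : (admissible d α).Nonempty) (n : ℕ) :
    0 ≤ factor d α n :=
  sub_nonneg.2 (div_le_one_of_le₀ (le_massA hd hne n) (massA_nonneg hd hne n))

theorem factor_le_one (hd : IsBaseDistribution d) (hne : (admissible d α).Nonempty) (n : ℕ) :
    factor d α n ≤ 1 :=
  sub_le_self _ (div_nonneg (hd.nonneg n) (massA_nonneg hd hne n))

theorem massA_le_one (hα : IsStochastic α) (hd : IsBaseDistribution d)
    (hne : (admissible d α).Nonempty) (n : ℕ) : massA d α n ≤ 1 := by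
  rw [massA_eq hd hne]
  exact (sub_le_self _ (Finset.sum_nonneg fun k _ => hd.nonneg k)).trans
    (sum_le_hasSum (range n) (fun j _ => hα.1 j) hα.2)

theorem tendsto_massA (hα : HasSum α 1) (hd : IsBaseDistribution d)
    (hne : (admissible d α).Nonempty) : Tendsto (massA d α) atTop (𝓝 0) := by
  simpa only [sub_self, ← massA_eq hd hne] using hα.tendsto_sum_nat.sub hd.hasSum.tendsto_sum_nat

/-- The part of the mass `α j` of the digit `j` that `optMatrix` leaves to the bases from `n` on:
each base `k > j` uses the proportion `d k / A_k` of what is left. -/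
noncomputable def remaining (d α : ℕ → ℝ) (j n : ℕ) : ℝ :=
  α j * ∏ k ∈ Finset.Ico (j + 1) n, factor d α k

theorem remaining_succ {j n : ℕ} (h : j < n) :
    remaining d α j (n + 1) = remaining d α j n * factor d α n := by
  rw [remaining, remaining, Finset.prod_Ico_succ_top h, mul_assoc]

theorem remaining_self_succ (j : ℕ) : remaining d α j (j + 1) = α j := by
  simp [remaining]

theorem remaining_nonneg (hα : ∀ j, 0 ≤ α j) (hd : IsBaseDistribution d)
    (hne : (admissible d α).Nonempty) (j n : ℕ) : 0 ≤ remaining d α j n :=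
  mul_nonneg (hα j) (Finset.prod_nonneg fun k _ => factor_nonneg hd hne k)

theorem sum_remaining (hd : IsBaseDistribution d) (hne : (admissible d α).Nonempty) (n : ℕ) :
    ∑ j ∈ range n, remaining d α j n = massA d α n := by
  induction n with
  | zero => simp [massA]
  | succ n ih =>
    rw [Finset.sum_range_succ, remaining_self_succ, massA_succ hd hne, ← massA_mul_factor hd hne,
      ← ih, Finset.sum_mul]
    exact congrArg (· + α n)
      (Finset.sum_congr rfl fun j hj => remaining_succ (Finset.mem_range.1 hj))

theorem tendsto_remaining (hα : IsStochastic α) (hd : IsBaseDistribution d)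
    (hne : (admissible d α).Nonempty) (j : ℕ) : Tendsto (remaining d α j) atTop (𝓝 0) := by
  refine tendsto_of_tendsto_of_tendsto_of_le_of_le' tendsto_const_nhds
    (tendsto_massA hα.2 hd hne)
    (Eventually.of_forall fun n => remaining_nonneg hα.1 hd hne j n) ?_
  filter_upwards [eventually_gt_atTop j] with n hn
  rw [← sum_remaining hd hne n]
  exact Finset.single_le_sum (f := fun j => remaining d α j n)
    (fun i _ => remaining_nonneg hα.1 hd hne i n) (Finset.mem_range.2 hn)

theorem optMatrix_eq_remaining_div {n j : ℕ} (hn : jMin α < n) (hA : massA d α n ≠ 0)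
    (hj : j < n) : optMatrix d α n j = remaining d α j n / massA d α n := by
  rw [optMatrix, if_pos ⟨hn, hA⟩]
  split_ifs with h
  · rw [remaining, mul_div_right_comm]
  · rw [remaining, eq_zero_of_lt_jMin (by lia : j < jMin α), zero_mul, zero_div]

theorem optMatrix_eq_of_ne_zero (hd : IsBaseDistribution d) (hne : (admissible d α).Nonempty)
    {n j : ℕ} (hn : d n ≠ 0) (hj : j < n) :
    optMatrix d α n j = remaining d α j n / massA d α n :=
  optMatrix_eq_remaining_div (not_le.1 fun h => hn (eq_zero_of_le_jMin hd hne h))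
    (massA_pos hd hne hn).ne' hj

theorem optMatrix_eq_zero {n j : ℕ} (h : n ≤ j) : optMatrix d α n j = 0 := by
  simp [optMatrix, h.not_gt]

theorem optMatrix_eq_mul {n j : ℕ} (hj : jMin α ≤ j) (hjn : j < n) (hA : massA d α n ≠ 0)
    (ht : ∏ k ∈ Finset.Icc (jMin α + 1) j, factor d α k ≠ 0) :
    optMatrix d α n j = rSeq d α n * tSeq d α j := by
  have hprod : ∏ k ∈ Finset.Ico (jMin α + 1) n, factor d α k =
      (∏ k ∈ Finset.Icc (jMin α + 1) j, factor d α k) *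
        ∏ k ∈ Finset.Ico (j + 1) n, factor d α k :=
    (Finset.prod_Ico_consecutive _ (by lia) (by lia)).symm
  rw [optMatrix_eq_remaining_div (by lia) hA hjn, remaining, rSeq, tSeq, hprod]
  field_simp

theorem optMatrix_mem_stochMatrices (hα : ∀ j, 0 ≤ α j) (hd : IsBaseDistribution d)
    (hne : (admissible d α).Nonempty) : optMatrix d α ∈ stochMatrices := by
  intro n hn
  by_cases h : jMin α < n ∧ massA d α n ≠ 0
  · refine ⟨fun j => ?_, fun j => optMatrix_eq_zero, ?_⟩
    · rcases lt_or_ge j n with hj | hj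
      · rw [optMatrix_eq_remaining_div h.1 h.2 hj]
        exact div_nonneg (remaining_nonneg hα hd hne j n) (massA_nonneg hd hne n)
      · rw [optMatrix_eq_zero hj]
    · rw [Finset.sum_congr rfl fun j hj =>
          optMatrix_eq_remaining_div h.1 h.2 (Finset.mem_range.1 hj),
        ← Finset.sum_div, sum_remaining hd hne, div_self h.2]
  · have huniform (j : ℕ) : optMatrix d α n j = if j < n then 1 / (n : ℝ) else 0 := if_neg h
    refine ⟨fun j => ?_, fun j => optMatrix_eq_zero, ?_⟩
    · rw [huniform]
      positivity
    · rw [Finset.sum_congr rfl fun j hj => (huniform j).trans (if_pos (Finset.mem_range.1 hj)),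
        Finset.sum_const, Finset.card_range, nsmul_eq_mul]
      exact mul_one_div_cancel (by positivity)

theorem mul_optMatrix (hd : IsBaseDistribution d) (hne : (admissible d α).Nonempty) {n j : ℕ}
    (hj : j < n) : d n * optMatrix d α n j = remaining d α j n - remaining d α j (n + 1) := by
  rw [remaining_succ hj, factor]
  by_cases h : d n = 0
  · simp [h]
  · rw [optMatrix_eq_of_ne_zero hd hne h hj]
    ring

theorem sum_range_mul_optMatrix (hd : IsBaseDistribution d) (hne : (admissible d α).Nonempty)
    {j N : ℕ} (hN : j < N) :
    ∑ n ∈ range N, d n * optMatrix d α n j = α j - remaining d α j N := by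
  induction N, hN using Nat.le_induction with
  | base =>
    rw [remaining_self_succ, sub_self]
    exact Finset.sum_eq_zero fun n hn => by
      rw [optMatrix_eq_zero (Nat.lt_succ_iff.1 (Finset.mem_range.1 hn)), mul_zero]
  | succ N hN ih =>
    rw [Finset.sum_range_succ, ih, mul_optMatrix hd hne hN]
    ring

theorem optMatrix_mem_admissible (hα : IsStochastic α) (hd : IsBaseDistribution d)
    (hne : (admissible d α).Nonempty) : optMatrix d α ∈ admissible d α := by
  have hstoch := optMatrix_mem_stochMatrices hα.1 hd hne
  refine ⟨hstoch, fun j => ?_⟩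
  rw [hd.ite_two_le (optMatrix d α · j),
    hasSum_iff_tendsto_nat_of_nonneg fun n => mul_entry_nonneg hd hstoch n j]
  have hlim : Tendsto (fun N => α j - remaining d α j N) atTop (𝓝 (α j)) := by
    simpa using tendsto_const_nhds.sub (tendsto_remaining hα hd hne j)
  refine hlim.congr' ?_
  filter_upwards [eventually_gt_atTop j] with N hN
  exact (sum_range_mul_optMatrix hd hne hN).symm

end OptMatrix

section Entropy

theorem sum_negMulLog_le {ι : Type*} {s : Finset ι} {p q : ι → ℝ} (hp : ∀ j ∈ s, 0 ≤ p j)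
    (hq : ∀ j ∈ s, 0 ≤ q j) (hpq : ∀ j ∈ s, p j ≠ 0 → q j ≠ 0)
    (hsum : ∑ j ∈ s, q j ≤ ∑ j ∈ s, p j) :
    ∑ j ∈ s, Real.negMulLog (p j) ≤ ∑ j ∈ s, p j * -Real.log (q j) := by
  have termwise (j) (hj : j ∈ s) : Real.negMulLog (p j) - p j * -Real.log (q j) ≤ q j - p j := by
    by_cases h0 : p j = 0
    · simp [h0, hq j hj]
    have hp0 : 0 < p j := (hp j hj).lt_of_ne' h0
    have hq0 : 0 < q j := (hq j hj).lt_of_ne' (hpq j hj h0)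
    calc Real.negMulLog (p j) - p j * -Real.log (q j) = p j * Real.log (q j / p j) := by
          rw [Real.negMulLog, Real.log_div hq0.ne' hp0.ne']
          ring
      _ ≤ p j * (q j / p j - 1) :=
          mul_le_mul_of_nonneg_left (Real.log_le_sub_one_of_pos (div_pos hq0 hp0)) hp0.le
      _ = q j - p j := by field_simp
  have hle := Finset.sum_le_sum termwise
  rw [Finset.sum_sub_distrib, Finset.sum_sub_distrib] at hle
  linarith

/-- The entropy of the `n`-th row of `P`. -/
noncomputable def rowEntropy (P : ℕ → ℕ → ℝ) (n : ℕ) : ℝ :=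
  ∑ j ∈ range n, Real.negMulLog (P n j)

variable {P : ℕ → ℕ → ℝ}

theorem entry_le_one (hP : P ∈ stochMatrices) {n : ℕ} (hn : 2 ≤ n) (j : ℕ) : P n j ≤ 1 := by
  rw [← sum_range_row hP hn (le_max_left n (j + 1))]
  exact Finset.single_le_sum (fun i _ => (hP n hn).1 i)
    (Finset.mem_range.2 (lt_max_of_lt_right j.lt_succ_self))

theorem rowEntropy_nonneg (hP : P ∈ stochMatrices) {n : ℕ} (hn : 2 ≤ n) : 0 ≤ rowEntropy P n :=
  Finset.sum_nonneg fun j _ => Real.negMulLog_nonneg ((hP n hn).1 j) (entry_le_one hP hn j)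

theorem rowEntropy_le_log (hP : P ∈ stochMatrices) {n : ℕ} (hn : 2 ≤ n) :
    rowEntropy P n ≤ Real.log n := by
  have hn0 : (n : ℝ) ≠ 0 := by positivity
  refine (sum_negMulLog_le (q := fun _ => (n : ℝ)⁻¹) (fun j _ => (hP n hn).1 j)
    (fun _ _ => by positivity) (fun _ _ _ => inv_ne_zero hn0) ?_).trans_eq ?_
  · simp [hn0, (hP n hn).2.2]
  · rw [← Finset.sum_mul, (hP n hn).2.2, one_mul, Real.log_inv, neg_neg]

variable {d : ℕ → ℝ}

theorem mul_rowEntropy_nonneg (hd : IsBaseDistribution d) (hP : P ∈ stochMatrices) (n : ℕ) :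
    0 ≤ d n * rowEntropy P n := by
  rcases lt_or_ge n 2 with hn | hn
  · rw [hd.eq_zero_of_lt_two n hn, zero_mul]
  · exact mul_nonneg (hd.nonneg n) (rowEntropy_nonneg hP hn)

theorem mul_rowEntropy_le_mul_log (hd : IsBaseDistribution d) (hP : P ∈ stochMatrices) (n : ℕ) :
    d n * rowEntropy P n ≤ d n * Real.log n := by
  rcases lt_or_ge n 2 with hn | hn
  · rw [hd.eq_zero_of_lt_two n hn, zero_mul, zero_mul]
  · exact mul_le_mul_of_nonneg_left (rowEntropy_le_log hP hn) (hd.nonneg n)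

theorem summable_mul_rowEntropy (hd : IsBaseDistribution d) (hP : P ∈ stochMatrices)
    (hlog : Summable fun n : ℕ => d n * Real.log n) : Summable fun n => d n * rowEntropy P n :=
  hlog.of_nonneg_of_le (mul_rowEntropy_nonneg hd hP) (mul_rowEntropy_le_mul_log hd hP)

theorem entropyQuotient_eq (hd : IsBaseDistribution d) (P : ℕ → ℕ → ℝ) :
    entropyQuotient d P = (∑' n, d n * rowEntropy P n) / ∑' n : ℕ, d n * Real.log n := by
  rw [entropyQuotient, ← hd.ite_two_le (rowEntropy P), ← hd.ite_two_le fun n => Real.log n]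
  simp only [rowEntropy, Real.negMulLog, neg_mul, Finset.sum_neg_distrib, mul_neg]

theorem tsum_mul_log_pos (hd : IsBaseDistribution d)
    (hlog : Summable fun n : ℕ => d n * Real.log n) : 0 < ∑' n : ℕ, d n * Real.log n := by
  refine (Real.log_pos one_lt_two).trans_le ?_
  have hle := hasSum_le (fun n => ?_) (hd.hasSum.mul_right (Real.log 2)) hlog.hasSum
  · rwa [one_mul] at hle
  · rcases lt_or_ge n 2 with hn | hn
    · simp [hd.eq_zero_of_lt_two n hn]
    · exact mul_le_mul_of_nonneg_left (Real.log_le_log two_pos (by exact_mod_cast hn))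
        (hd.nonneg n)

end Entropy

section Loss

variable {d α : ℕ → ℝ} {P : ℕ → ℕ → ℝ}

theorem two_le_of_ne_zero (hd : IsBaseDistribution d) {n : ℕ} (hn : d n ≠ 0) : 2 ≤ n :=
  not_lt.1 fun h => hn (hd.eq_zero_of_lt_two n h)

theorem optMatrix_ne_zero (hd : IsBaseDistribution d) (hP : P ∈ admissible d α) {n j : ℕ}
    (hj : j < n) (hn : d n ≠ 0) (h : P n j ≠ 0) : optMatrix d α n j ≠ 0 := by
  have hne : (admissible d α).Nonempty := ⟨P, hP⟩
  have hpos : 0 < d n * P n j := (mul_entry_nonneg hd hP.1 n j).lt_of_ne' (mul_ne_zero hn h)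
  rw [optMatrix_eq_of_ne_zero hd hne hn hj]
  refine div_ne_zero (mul_ne_zero ?_ (Finset.prod_ne_zero_iff.2 fun k hk hfactor => ?_))
    (massA_pos hd hne hn).ne'
  · exact (hpos.trans_le (le_hasSum (hasSum_mul_entry hd hP j) n fun m _ =>
      mul_entry_nonneg hd hP.1 m j)).ne'
  · -- If `factor d α k = 0`, the bases up to `k` exhaust the digits below `k`.
    obtain ⟨hjk, hkn⟩ := Finset.mem_Ico.1 hk
    have hexhausted := massA_mul_factor hd hne k
    have hmass := sum_range_add_le hd hP hkn
    have hentry : d n * P n j ≤ d n * ∑ i ∈ range k, P n i :=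
      mul_le_mul_of_nonneg_left (Finset.single_le_sum
        (fun i _ => (hP.1 n (two_le_of_ne_zero hd hn)).1 i) (Finset.mem_range.2 hjk)) (hd.nonneg n)
    rw [hfactor, mul_zero, massA_eq hd hne] at hexhausted
    rw [Finset.sum_range_succ] at hmass
    linarith

theorem rowEntropy_le_sum_neg_log_optMatrix (hα : ∀ j, 0 ≤ α j) (hd : IsBaseDistribution d)
    (hP : P ∈ admissible d α) {n : ℕ} (hn : d n ≠ 0) :
    rowEntropy P n ≤ ∑ j ∈ range n, P n j * -Real.log (optMatrix d α n j) := by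
  have hn2 := two_le_of_ne_zero hd hn
  have hopt := optMatrix_mem_stochMatrices hα hd ⟨P, hP⟩ n hn2
  exact sum_negMulLog_le (fun j _ => (hP.1 n hn2).1 j) (fun j _ => hopt.1 j)
    (fun j hj => optMatrix_ne_zero hd hP (Finset.mem_range.1 hj) hn)
    (hopt.2.2.trans (hP.1 n hn2).2.2.symm).le

/-- The part of `-log p^α_{n,j}` depending on the digit `j`. The factors `1 - d_k / A_k`,
`j < k < n`, are extended to all `k < T` so that the dependence on the base `n < T` splits off. -/
noncomputable def digitLoss (d α : ℕ → ℝ) (T j : ℕ) : ℝ :=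
  if j < T then -Real.log (α j) - ∑ k ∈ Finset.Ico (j + 1) T, Real.log (factor d α k) else 0

/-- The part of `-log p^α_{n,j}` depending on the base `n`, complementary to `digitLoss`. -/
noncomputable def baseLoss (d α : ℕ → ℝ) (T n : ℕ) : ℝ :=
  if n < T then Real.log (massA d α n) + ∑ k ∈ Finset.Ico n T, Real.log (factor d α k) else 0

theorem neg_log_optMatrix (hd : IsBaseDistribution d) (hne : (admissible d α).Nonempty) {n j : ℕ}
    (hj : j < n) (hn : d n ≠ 0) (h : optMatrix d α n j ≠ 0) :
    -Real.log (optMatrix d α n j) = -Real.log (α j) -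
      ∑ k ∈ Finset.Ico (j + 1) n, Real.log (factor d α k) + Real.log (massA d α n) := by
  rw [optMatrix_eq_of_ne_zero hd hne hn hj] at h ⊢
  have hrem : remaining d α j n ≠ 0 := (div_ne_zero_iff.1 h).1
  rw [Real.log_div hrem (massA_pos hd hne hn).ne', remaining,
    Real.log_mul (left_ne_zero_of_mul hrem) (right_ne_zero_of_mul hrem),
    Real.log_prod (Finset.prod_ne_zero_iff.1 (right_ne_zero_of_mul hrem))]
  ring

theorem digitLoss_add_baseLoss (hd : IsBaseDistribution d) (hne : (admissible d α).Nonempty)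
    {T n j : ℕ} (hnT : n < T) (hj : j < n) (hn : d n ≠ 0) (h : optMatrix d α n j ≠ 0) :
    digitLoss d α T j + baseLoss d α T n = -Real.log (optMatrix d α n j) := by
  rw [neg_log_optMatrix hd hne hj hn h, digitLoss, baseLoss, if_pos (hj.trans hnT), if_pos hnT,
    ← Finset.sum_Ico_consecutive _ hj hnT.le]
  ring

theorem neg_log_factor_nonneg (hd : IsBaseDistribution d) (hne : (admissible d α).Nonempty)
    (k : ℕ) : 0 ≤ -Real.log (factor d α k) :=
  neg_nonneg.2 (Real.log_nonpos (factor_nonneg hd hne k) (factor_le_one hd hne k))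

theorem neg_log_nonneg (hα : IsStochastic α) (j : ℕ) : 0 ≤ -Real.log (α j) :=
  neg_nonneg.2 (Real.log_nonpos (hα.1 j) (le_hasSum hα.2 j fun i _ => hα.1 i))

theorem digitLoss_nonneg (hα : IsStochastic α) (hd : IsBaseDistribution d)
    (hne : (admissible d α).Nonempty) (T j : ℕ) : 0 ≤ digitLoss d α T j := by
  unfold digitLoss
  split_ifs
  · rw [sub_eq_add_neg, ← Finset.sum_neg_distrib]
    exact add_nonneg (neg_log_nonneg hα j)
      (Finset.sum_nonneg fun k _ => neg_log_factor_nonneg hd hne k)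
  · exact le_rfl

theorem digitLoss_mono (hα : IsStochastic α) (hd : IsBaseDistribution d)
    (hne : (admissible d α).Nonempty) {T n : ℕ} (hTn : T ≤ n) (j : ℕ) :
    digitLoss d α T j ≤ digitLoss d α n j := by
  by_cases hj : j < T
  · rw [digitLoss, digitLoss, if_pos hj, if_pos (hj.trans_le hTn), sub_eq_add_neg, sub_eq_add_neg,
      ← Finset.sum_neg_distrib, ← Finset.sum_neg_distrib]
    gcongr
    exact fun k _ _ => neg_log_factor_nonneg hd hne k
  · rw [digitLoss, if_neg hj]
    exact digitLoss_nonneg hα hd hne n j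

theorem digitLoss_self (hd : IsBaseDistribution d) (hne : (admissible d α).Nonempty)
    {n j : ℕ} (hj : j < n) (hn : d n ≠ 0) (h : optMatrix d α n j ≠ 0) :
    digitLoss d α n j = -Real.log (optMatrix d α n j) - Real.log (massA d α n) := by
  rw [neg_log_optMatrix hd hne hj hn h, digitLoss, if_pos hj]
  ring

/-- The mean of `digitLoss + baseLoss` when the digits have distribution `α` and the bases `d`. -/
noncomputable def lossBound (d α : ℕ → ℝ) (T : ℕ) : ℝ :=
  ∑ j ∈ range T, α j * digitLoss d α T j + ∑ n ∈ range T, d n * baseLoss d α T n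

theorem hasSum_mul_digitLoss_add_baseLoss (hd : IsBaseDistribution d) (hP : P ∈ admissible d α)
    (T : ℕ) :
    HasSum (fun n => d n * ∑ j ∈ range n, P n j * (digitLoss d α T j + baseLoss d α T n))
      (lossBound d α T) := by
  have hdigit : HasSum (fun n => ∑ j ∈ range T, d n * P n j * digitLoss d α T j)
      (∑ j ∈ range T, α j * digitLoss d α T j) :=
    hasSum_sum fun j _ => (hasSum_mul_entry hd hP j).mul_right _
  have hbase : HasSum (fun n => d n * baseLoss d α T n)
      (∑ n ∈ range T, d n * baseLoss d α T n) := by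
    refine hasSum_sum_of_ne_finset_zero fun n hn => ?_
    rw [baseLoss, if_neg (by simpa using hn), mul_zero]
  refine (hdigit.add hbase).congr_fun fun n => ?_
  rcases lt_or_ge n 2 with hn | hn
  · simp [hd.eq_zero_of_lt_two n hn]
  have hrow : ∑ j ∈ range n, P n j * digitLoss d α T j =
      ∑ j ∈ range T, P n j * digitLoss d α T j := by
    rw [Finset.eventually_constant_sum (N := min n T) (fun j hj => ?_) (min_le_left n T),
      Finset.eventually_constant_sum (N := min n T) (fun j hj => ?_) (min_le_right n T)]
    all_goals
      rcases min_le_iff.1 hj with hnj | hTj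
      · rw [(hP.1 n hn).2.1 j hnj, zero_mul]
      · rw [digitLoss, if_neg hTj.not_gt, mul_zero]
  rw [Finset.sum_congr rfl fun j _ => mul_add _ _ _, Finset.sum_add_distrib, hrow,
    ← Finset.sum_mul, (hP.1 n hn).2.2, one_mul, mul_add, Finset.mul_sum]
  simp_rw [mul_assoc]

theorem sum_mul_rowEntropy_le_lossBound (hα : IsStochastic α) (hd : IsBaseDistribution d)
    (hP : P ∈ admissible d α) (T : ℕ) : ∑ n ∈ range T, d n * rowEntropy P n ≤ lossBound d α T := by
  have hne : (admissible d α).Nonempty := ⟨P, hP⟩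
  have hrow (n) (hnT : n < T) : d n * rowEntropy P n ≤
      d n * ∑ j ∈ range n, P n j * (digitLoss d α T j + baseLoss d α T n) := by
    by_cases hn : d n = 0
    · simp [hn]
    refine mul_le_mul_of_nonneg_left ((rowEntropy_le_sum_neg_log_optMatrix hα.1 hd hP hn).trans_eq
      (Finset.sum_congr rfl fun j hj => ?_)) (hd.nonneg n)
    by_cases hentry : P n j = 0
    · simp [hentry]
    have hjn := Finset.mem_range.1 hj
    rw [digitLoss_add_baseLoss hd hne hnT hjn hn (optMatrix_ne_zero hd hP hjn hn hentry)]
  refine (Finset.sum_le_sum fun n hn => hrow n (Finset.mem_range.1 hn)).trans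
    (sum_le_hasSum _ (fun n hn => ?_) (hasSum_mul_digitLoss_add_baseLoss hd hP T))
  rw [baseLoss, if_neg (by simpa using hn), Finset.mul_sum]
  refine Finset.sum_nonneg fun j _ => ?_
  rw [← mul_assoc, add_zero]
  exact mul_nonneg (mul_entry_nonneg hd hP.1 n j) (digitLoss_nonneg hα hd hne T j)

theorem mul_sum_optMatrix_loss_le (hα : IsStochastic α) (hd : IsBaseDistribution d)
    (hne : (admissible d α).Nonempty) (T n : ℕ) :
    d n * ∑ j ∈ range n, optMatrix d α n j * (digitLoss d α T j + baseLoss d α T n) ≤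
      d n * rowEntropy (optMatrix d α) n +
        if n < T then 0 else d n * -Real.log (massA d α n) := by
  by_cases hn : d n = 0
  · simp [hn]
  have hopt := optMatrix_mem_stochMatrices hα.1 hd hne n (two_le_of_ne_zero hd hn)
  have hloss (j) (hj : j < n) (h0 : optMatrix d α n j ≠ 0) :
      digitLoss d α T j + baseLoss d α T n ≤
        -Real.log (optMatrix d α n j) + if n < T then 0 else -Real.log (massA d α n) := by
    split_ifs with hnT
    · rw [digitLoss_add_baseLoss hd hne hnT hj hn h0, add_zero]
    · rw [baseLoss, if_neg hnT, add_zero, ← sub_eq_add_neg, ← digitLoss_self hd hne hj hn h0]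
      exact digitLoss_mono hα hd hne (not_lt.1 hnT) j
  have hrow : ∑ j ∈ range n, optMatrix d α n j * (digitLoss d α T j + baseLoss d α T n) ≤
      rowEntropy (optMatrix d α) n + if n < T then 0 else -Real.log (massA d α n) := by
    calc ∑ j ∈ range n, optMatrix d α n j * (digitLoss d α T j + baseLoss d α T n)
        ≤ ∑ j ∈ range n, optMatrix d α n j *
          (-Real.log (optMatrix d α n j) + if n < T then 0 else -Real.log (massA d α n)) := by
          refine Finset.sum_le_sum fun j hj => ?_
          by_cases h0 : optMatrix d α n j = 0
          · simp [h0]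
          · exact mul_le_mul_of_nonneg_left (hloss j (Finset.mem_range.1 hj) h0) (hopt.1 j)
      _ = rowEntropy (optMatrix d α) n + if n < T then 0 else -Real.log (massA d α n) := by
          simp_rw [mul_add, Finset.sum_add_distrib, ← Finset.sum_mul, hopt.2.2, one_mul,
            rowEntropy, Real.negMulLog, neg_mul, mul_neg]
  simpa only [mul_add, mul_ite, mul_zero] using mul_le_mul_of_nonneg_left hrow (hd.nonneg n)

theorem summable_mul_neg_log_massA (hα : IsStochastic α) (hd : IsBaseDistribution d)
    (hne : (admissible d α).Nonempty) (hlog : Summable fun n : ℕ => d n * Real.log n) :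
    Summable fun n => d n * -Real.log (massA d α n) := by
  have hsq : Summable fun n : ℕ => 1 / (n : ℝ) ^ 2 := Real.summable_one_div_nat_pow.2 one_lt_two
  refine ((hlog.mul_left 2).add hsq).of_nonneg_of_le (fun n => mul_nonneg (hd.nonneg n)
    (neg_nonneg.2 (Real.log_nonpos (massA_nonneg hd hne n) (massA_le_one hα hd hne n))))
    fun n => ?_
  by_cases hn : d n = 0
  · simp [hn]
  have hdn : 0 < d n := (hd.nonneg n).lt_of_ne' hn
  have hn0 : (0 : ℝ) < n := by have := two_le_of_ne_zero hd hn; positivity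
  -- `-log x ≤ log y + 1 / (x y) - 1` with `x = d n` and `y = n ^ 2`
  have hgibbs := Real.log_le_sub_one_of_pos (show 0 < 1 / (n : ℝ) ^ 2 / d n by positivity)
  rw [Real.log_div (by positivity) hn, Real.log_div one_ne_zero (by positivity), Real.log_pow,
    Real.log_one] at hgibbs
  push_cast at hgibbs
  calc d n * -Real.log (massA d α n) ≤ d n * -Real.log (d n) := by
        gcongr
        exact le_massA hd hne n
    _ ≤ d n * (2 * Real.log n + (1 / (n : ℝ) ^ 2 / d n - 1)) := by
        gcongr
        linarith
    _ ≤ 2 * (d n * Real.log n) + 1 / (n : ℝ) ^ 2 := by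
        have hcancel : d n * (1 / (n : ℝ) ^ 2 / d n) = 1 / (n : ℝ) ^ 2 := by field_simp
        linarith

theorem lossBound_le (hα : IsStochastic α) (hd : IsBaseDistribution d)
    (hne : (admissible d α).Nonempty) (hlog : Summable fun n : ℕ => d n * Real.log n) (T : ℕ) :
    lossBound d α T ≤ ∑' n, d n * rowEntropy (optMatrix d α) n +
      (∑' n, d n * -Real.log (massA d α n) -
        ∑ n ∈ range T, d n * -Real.log (massA d α n)) := by
  have hopt := optMatrix_mem_admissible hα hd hne
  have htail := (summable_mul_neg_log_massA hα hd hne hlog).hasSum.sub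
    (hasSum_sum_of_ne_finset_zero (s := range T)
      (f := fun n => if n < T then d n * -Real.log (massA d α n) else 0)
      fun n hn => if_neg (by simpa using hn))
  rw [Finset.sum_congr rfl fun n hn => if_pos (Finset.mem_range.1 hn)] at htail
  refine hasSum_le (fun n => (mul_sum_optMatrix_loss_le hα hd hne T n).trans_eq ?_)
    (hasSum_mul_digitLoss_add_baseLoss hd hopt T)
    ((summable_mul_rowEntropy hd hopt.1 hlog).hasSum.add htail)
  split_ifs <;> ring

theorem eventually_lossBound_le (hα : IsStochastic α) (hd : IsBaseDistribution d)
    (hne : (admissible d α).Nonempty) (hlog : Summable fun n : ℕ => d n * Real.log n) {ε : ℝ}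
    (hε : 0 < ε) :
    ∀ᶠ T in atTop, lossBound d α T ≤ ∑' n, d n * rowEntropy (optMatrix d α) n + ε := by
  have htail := (summable_mul_neg_log_massA hα hd hne hlog).hasSum.tendsto_sum_nat
  filter_upwards [htail.eventually (lt_mem_nhds (sub_lt_self _ hε))] with T hT
  linarith [lossBound_le hα hd hne hlog T]

theorem tsum_mul_rowEntropy_le (hα : IsStochastic α) (hd : IsBaseDistribution d)
    (hlog : Summable fun n : ℕ => d n * Real.log n) (hP : P ∈ admissible d α) :
    ∑' n, d n * rowEntropy P n ≤ ∑' n, d n * rowEntropy (optMatrix d α) n := by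
  refine le_of_forall_pos_le_add fun ε hε =>
    le_of_tendsto (summable_mul_rowEntropy hd hP.1 hlog).hasSum.tendsto_sum_nat ?_
  filter_upwards [eventually_lossBound_le hα hd ⟨P, hP⟩ hlog hε] with T hT
  exact (sum_mul_rowEntropy_le_lossBound hα hd hP T).trans hT

theorem isGreatest_entropyQuotient (hα : IsStochastic α) (hd : IsBaseDistribution d)
    (hne : (admissible d α).Nonempty) (hlog : Summable fun n : ℕ => d n * Real.log n) :
    IsGreatest (entropyQuotient d '' admissible d α) (entropyQuotient d (optMatrix d α)) := by
  refine ⟨⟨_, optMatrix_mem_admissible hα hd hne, rfl⟩, ?_⟩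
  rintro _ ⟨P, hP, rfl⟩
  rw [entropyQuotient_eq hd, entropyQuotient_eq hd]
  exact div_le_div_of_nonneg_right (tsum_mul_rowEntropy_le hα hd hlog hP)
    (tsum_mul_log_pos hd hlog).le

end Loss

section Expansion

/-- The product `b 0 ⋯ b (N - 1)`, the denominator of the partial sums of order `N`. -/
def baseProd (b : ℕ → ℕ) (N : ℕ) : ℕ := ∏ k ∈ range N, b k

/-- The sum `∑ e i / (b 0 ⋯ b i)` of the Cantor series with digits `e`. -/
noncomputable def cantorValue (b e : ℕ → ℕ) : ℝ := ∑' i, (e i : ℝ) / baseProd b (i + 1)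

variable {b e : ℕ → ℕ}

theorem baseProd_succ (b : ℕ → ℕ) (N : ℕ) : baseProd b (N + 1) = baseProd b N * b N :=
  Finset.prod_range_succ _ _

theorem base_pos (hb : ∀ i, 2 ≤ b i) (i : ℕ) : (0 : ℝ) < b i :=
  Nat.cast_pos.2 (zero_lt_two.trans_le (hb i))

theorem baseProd_pos (hb : ∀ i, 2 ≤ b i) (N : ℕ) : (0 : ℝ) < baseProd b N := by
  rw [baseProd, Nat.cast_prod]
  exact Finset.prod_pos fun i _ => base_pos hb i

theorem two_pow_le_baseProd (hb : ∀ i, 2 ≤ b i) (N : ℕ) : 2 ^ N ≤ baseProd b N := by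
  simpa only [Finset.card_range, baseProd] using
    Finset.pow_card_le_prod (range N) b 2 fun i _ => hb i

theorem tendsto_one_div_baseProd (hb : ∀ i, 2 ≤ b i) :
    Tendsto (fun N => 1 / (baseProd b N : ℝ)) atTop (𝓝 0) := by
  refine squeeze_zero (fun N => by positivity) (fun N => ?_)
    (tendsto_pow_atTop_nhds_zero_of_lt_one (r := (1 / 2 : ℝ)) (by norm_num) (by norm_num))
  rw [one_div_pow]
  exact one_div_le_one_div_of_le (by positivity) (by exact_mod_cast two_pow_le_baseProd hb N)

theorem log_baseProd (hb : ∀ i, 2 ≤ b i) (N : ℕ) :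
    Real.log (baseProd b N) = ∑ i ∈ range N, Real.log (b i) := by
  rw [baseProd, Nat.cast_prod, Real.log_prod fun i _ => (base_pos hb i).ne']

theorem sum_Ico_digits_le (hb : ∀ i, 2 ≤ b i) (he : ∀ i, e i < b i) {N n : ℕ} (hN : N ≤ n) :
    ∑ i ∈ Finset.Ico N n, (e i : ℝ) / baseProd b (i + 1) ≤
      1 / baseProd b N - 1 / baseProd b n := by
  have telescope (i : ℕ) : (e i : ℝ) / baseProd b (i + 1) ≤
      -(1 / baseProd b (i + 1)) - -(1 / baseProd b i) := by
    have hi : (e i : ℝ) + 1 ≤ b i := by exact_mod_cast he i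
    have hprod : (0 : ℝ) < baseProd b (i + 1) := baseProd_pos hb _
    have hinv : 1 / (baseProd b i : ℝ) = b i / baseProd b (i + 1) := by
      rw [baseProd_succ, Nat.cast_mul]
      field_simp [(base_pos hb i).ne', (baseProd_pos hb i).ne']
    rw [hinv, sub_neg_eq_add, neg_add_eq_sub, ← sub_div]
    gcongr
    linarith
  refine (Finset.sum_le_sum fun i _ => telescope i).trans_eq ?_
  rw [Finset.sum_Ico_sub (fun i => -(1 / (baseProd b i : ℝ))) hN]
  ring

theorem summable_digits (hb : ∀ i, 2 ≤ b i) (he : ∀ i, e i < b i) :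
    Summable fun i => (e i : ℝ) / baseProd b (i + 1) := by
  refine summable_of_sum_range_le (c := 1 / baseProd b 0) (fun i => by positivity) fun n => ?_
  rw [← Nat.Ico_zero_eq_range]
  exact (sum_Ico_digits_le hb he n.zero_le).trans (sub_le_self _ (by positivity))

theorem sum_range_le_cantorValue (hb : ∀ i, 2 ≤ b i) (he : ∀ i, e i < b i) (N : ℕ) :
    ∑ i ∈ range N, (e i : ℝ) / baseProd b (i + 1) ≤ cantorValue b e :=
  (summable_digits hb he).sum_le_tsum _ fun i _ => by positivity

theorem cantorValue_le (hb : ∀ i, 2 ≤ b i) (he : ∀ i, e i < b i) (N : ℕ) :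
    cantorValue b e ≤ ∑ i ∈ range N, (e i : ℝ) / baseProd b (i + 1) + 1 / baseProd b N := by
  refine le_of_tendsto (summable_digits hb he).hasSum.tendsto_sum_nat ?_
  filter_upwards [eventually_ge_atTop N] with n hn
  rw [← Finset.sum_range_add_sum_Ico _ hn]
  gcongr
  exact (sum_Ico_digits_le hb he hn).trans (sub_le_self _ (by positivity))

theorem cantorValue_digit (hb : ∀ i, 2 ≤ b i) {x : ℝ} (hx : x ∈ Set.Icc (0 : ℝ) 1) :
    cantorValue b (digit b x) = x :=
  (hasSum_digit hb hx).tsum_eq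

theorem abs_sub_le_of_digit_eq (hb : ∀ i, 2 ≤ b i) {x y : ℝ} (hx : x ∈ Set.Icc (0 : ℝ) 1)
    (hy : y ∈ Set.Icc (0 : ℝ) 1) {N : ℕ} (h : ∀ i < N, digit b x i = digit b y i) :
    |x - y| ≤ 1 / baseProd b N := by
  have hx_ge := sum_range_le_cantorValue hb (digit_lt hb x) N
  have hx_le := cantorValue_le hb (digit_lt hb x) N
  have hy_ge := sum_range_le_cantorValue hb (digit_lt hb y) N
  have hy_le := cantorValue_le hb (digit_lt hb y) N
  rw [cantorValue_digit hb hx] at hx_ge hx_le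
  rw [cantorValue_digit hb hy] at hy_ge hy_le
  rw [Finset.sum_congr rfl fun i hi => by rw [h i (Finset.mem_range.1 hi)]] at hx_ge hx_le
  rw [abs_le]
  constructor <;> linarith

end Expansion

section Covering

theorem dimH_le_of_covers {X : Type*} [EMetricSpace X] [MeasurableSpace X] [BorelSpace X]
    {E : Set X} {s : NNReal} {ι : ℕ → Type*} [∀ n, Fintype (ι n)] {r : ℕ → ENNReal}
    (hr : Tendsto r atTop (𝓝 0)) (t : ∀ n, ι n → Set X) (hE : ∀ n, E ⊆ ⋃ i, t n i)
    (hdiam : ∀ n i, Metric.ediam (t n i) ≤ r n) {C : ENNReal} (hC : C ≠ ⊤)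
    (hcard : ∀ n, Fintype.card (ι n) * r n ^ (s : ℝ) ≤ C) : dimH E ≤ s := by
  refine dimH_le_of_hausdorffMeasure_ne_top (ne_top_of_le_ne_top hC ?_)
  refine (Measure.hausdorffMeasure_le_liminf_sum (s : ℝ) E r hr t
    (Eventually.of_forall hdiam) (Eventually.of_forall hE)).trans ?_
  have hsum (n : ℕ) : ∑ i, Metric.ediam (t n i) ^ (s : ℝ) ≤ C := by
    refine (Finset.sum_le_card_nsmul _ _ (r n ^ (s : ℝ)) fun i _ =>
      ENNReal.rpow_le_rpow (hdiam n i) s.2).trans ?_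
    rw [nsmul_eq_mul]
    exact hcard n
  refine liminf_le_of_le (by isBoundedDefault) fun a ha => ?_
  obtain ⟨n, hn⟩ := ha.exists
  exact hn.trans (hsum n)

theorem card_words_mul_le_one {n : ℕ} {b : Fin n → ℕ} {w : Fin n → ℕ → ℝ} (hw : ∀ i j, 0 ≤ w i j)
    (hsum : ∀ i, ∑ j ∈ range (b i), w i j ≤ 1) (c : ℝ) :
    (#{v ∈ Fintype.piFinset fun i => range (b i) | c ≤ ∏ i, w i (v i)} : ℝ) * c ≤ 1 := by
  set words := Fintype.piFinset fun i => range (b i)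
  calc (#{v ∈ words | c ≤ ∏ i, w i (v i)} : ℝ) * c
      ≤ ∑ v ∈ words with c ≤ ∏ i, w i (v i), ∏ i, w i (v i) := by
        rw [← nsmul_eq_mul]
        exact Finset.card_nsmul_le_sum _ _ _ fun v hv => (Finset.mem_filter.1 hv).2
    _ ≤ ∑ v ∈ words, ∏ i, w i (v i) :=
        Finset.sum_le_sum_of_subset_of_nonneg (Finset.filter_subset _ _) fun v _ _ =>
          Finset.prod_nonneg fun i _ => hw _ _
    _ = ∏ i, ∑ j ∈ range (b i), w i j := (Finset.prod_univ_sum _ _).symm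
    _ ≤ 1 := Finset.prod_le_one (fun i _ => Finset.sum_nonneg fun j _ => hw _ _) fun i _ => hsum i

theorem dimH_le_of_weight {b : ℕ → ℕ} (hb : ∀ i, 2 ≤ b i) {E : Set ℝ} (hE : E ⊆ Set.Icc 0 1)
    {s : NNReal} {w : ℕ → ℕ → ℝ} (hw : ∀ i j, 0 ≤ w i j)
    (hsum : ∀ i, ∑ j ∈ range (b i), w i j ≤ 1)
    (h : ∃ᶠ N in atTop, ∀ x ∈ E,
      (baseProd b N : ℝ) ^ (-(s : ℝ)) ≤ ∏ i ∈ range N, w i (digit b x i)) :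
    dimH E ≤ s := by
  obtain ⟨φ, hφ, hweight⟩ := Filter.extraction_of_frequently_atTop h
  let words (n : ℕ) : Finset (Fin (φ n) → ℕ) :=
    {v ∈ Fintype.piFinset fun i : Fin (φ n) => range (b i) |
      (baseProd b (φ n) : ℝ) ^ (-(s : ℝ)) ≤ ∏ i : Fin (φ n), w i (v i)}
  let cylinder (n : ℕ) (v : words n) : Set ℝ :=
    {x | x ∈ E ∧ ∀ i : Fin (φ n), digit b x i = v.1 i}
  have hr : Tendsto (fun n => ENNReal.ofReal (1 / baseProd b (φ n))) atTop (𝓝 0) := by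
    rw [← ENNReal.ofReal_zero]
    exact ENNReal.tendsto_ofReal ((tendsto_one_div_baseProd hb).comp hφ.tendsto_atTop)
  refine dimH_le_of_covers hr cylinder (fun n x hx => ?_) (fun n v => ?_) ENNReal.one_ne_top
    fun n => ?_
  · refine Set.mem_iUnion.2 ⟨⟨fun i => digit b x i, Finset.mem_filter.2 ⟨?_, ?_⟩⟩, hx, fun i => rfl⟩
    · exact Fintype.mem_piFinset.2 fun i => Finset.mem_range.2 (digit_lt hb x i)
    · rw [Fin.prod_univ_eq_prod_range (fun i => w i (digit b x i)) (φ n)]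
      exact hweight n x hx
  · refine Metric.ediam_le fun x hx y hy => ?_
    rw [edist_dist, Real.dist_eq]
    refine ENNReal.ofReal_le_ofReal (abs_sub_le_of_digit_eq hb (hE hx.1) (hE hy.1) fun i hi => ?_)
    rw [hx.2 ⟨i, hi⟩, hy.2 ⟨i, hi⟩]
  · have hpos := baseProd_pos hb (φ n)
    rw [ENNReal.ofReal_rpow_of_pos (by positivity), one_div, Real.inv_rpow hpos.le,
      ← Real.rpow_neg hpos.le, Fintype.card_coe, ← ENNReal.ofReal_natCast,
      ← ENNReal.ofReal_mul (by positivity)]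
    exact ENNReal.ofReal_le_one.2
      (card_words_mul_le_one (fun i => hw i) (fun i => hsum i) _)

end Covering

section UpperBound

variable {b e : ℕ → ℕ} {d α : ℕ → ℝ}

theorem HasFrequency.zero_of_comp {ι κ : Type*} [DecidableEq ι] [DecidableEq κ] {u : ℕ → ι}
    {a : ι} (f : ι → κ) (h : HasFrequency (fun i => f (u i)) (f a) 0) : HasFrequency u a 0 := by
  refine squeeze_zero (fun N => by positivity) (fun N => ?_) h
  gcongr
  exact Finset.card_le_card (Finset.monotone_filter_right _ fun i _ hi => congrArg f hi)

theorem hasFrequency_pair_zero_of_factor_eq_zero (hfreq : IsBaseFrequency b d)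
    (hd : IsBaseDistribution d) (hne : (admissible d α).Nonempty) (he : ∀ i, e i < b i)
    (hα : ∀ j, HasFrequency e j (α j)) {n j k : ℕ} (hjk : j < k) (hkn : k < n)
    (hk : factor d α k = 0) : HasFrequency (fun i => (b i, e i)) (n, j) 0 := by
  have hlim := (tendsto_average_of_hasFrequency (s := range k) (fun j _ => hα j) 1).sub
    (tendsto_average_of_hasFrequency (u := b) (s := range (k + 1)) (fun n _ => hfreq n) 1)
  have mass_eq_zero : ∑ j ∈ range k, α j * 1 - ∑ n ∈ range (k + 1), d n * 1 = 0 := by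
    have h := massA_mul_factor hd hne k
    rw [hk, mul_zero, massA_eq hd hne] at h
    simp only [mul_one, Finset.sum_range_succ _ k]
    linarith
  simp only [Pi.one_apply, mass_eq_zero] at hlim
  refine squeeze_zero (fun N => by positivity) (fun N => ?_) hlim
  rw [← sub_div, ← Finset.sum_sub_distrib, occurrences, ← Finset.sum_boole]
  refine div_le_div_of_nonneg_right (Finset.sum_le_sum fun i _ => ?_) N.cast_nonneg
  have := he i
  simp only [Finset.mem_range, Prod.mk.injEq]
  split_ifs <;> first | omega | norm_num

theorem hasFrequency_pair_zero_of_optMatrix_eq_zero (hfreq : IsBaseFrequency b d)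
    (hd : IsBaseDistribution d) (hne : (admissible d α).Nonempty) (he : ∀ i, e i < b i)
    (hα : ∀ j, HasFrequency e j (α j)) {n j : ℕ} (hj : j < n)
    (h : d n = 0 ∨ optMatrix d α n j = 0) : HasFrequency (fun i => (b i, e i)) (n, j) 0 := by
  by_cases hn : d n = 0
  · exact .zero_of_comp Prod.fst (hn ▸ hfreq n)
  have hrem := h.resolve_left hn
  rw [optMatrix_eq_of_ne_zero hd hne hn hj, div_eq_zero_iff, or_iff_left (massA_pos hd hne hn).ne',
    remaining, mul_eq_zero, Finset.prod_eq_zero_iff] at hrem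
  rcases hrem with hαj | ⟨k, hk, hfactor⟩
  · exact .zero_of_comp Prod.snd (hαj ▸ hα j)
  · rw [Finset.mem_Ico] at hk
    exact hasFrequency_pair_zero_of_factor_eq_zero hfreq hd hne he hα hk.1 hk.2 hfactor

/-- Positive digit weights used to cover `J_A(α)`: a mixture of `P` with the uniform distribution
for bases below `T`, the uniform distribution for the other bases. -/
noncomputable def mixedWeight (P : ℕ → ℕ → ℝ) (T : ℕ) (δ : ℝ) (n j : ℕ) : ℝ :=
  if n < T then (1 - δ) * P n j + δ * (n : ℝ)⁻¹ else (n : ℝ)⁻¹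

theorem sum_mixedWeight {P : ℕ → ℕ → ℝ} (hP : P ∈ stochMatrices) (T : ℕ) (δ : ℝ) {n : ℕ}
    (hn : 2 ≤ n) : ∑ j ∈ range n, mixedWeight P T δ n j = 1 := by
  have hsum : ∑ _j ∈ range n, (n : ℝ)⁻¹ = 1 := by
    rw [Finset.sum_const, Finset.card_range, nsmul_eq_mul,
      mul_inv_cancel₀ (Nat.cast_ne_zero.2 (by omega))]
  unfold mixedWeight
  split_ifs
  · rw [Finset.sum_add_distrib, ← Finset.mul_sum, ← Finset.mul_sum, (hP n hn).2.2, hsum]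
    ring
  · exact hsum

theorem mixedWeight_pos {P : ℕ → ℕ → ℝ} (hP : P ∈ stochMatrices) (T : ℕ) {δ : ℝ} (hδ : 0 < δ)
    (hδ1 : δ < 1) {n : ℕ} (hn : 2 ≤ n) (j : ℕ) : 0 < mixedWeight P T δ n j := by
  have hinv : (0 : ℝ) < (n : ℝ)⁻¹ := inv_pos.2 (Nat.cast_pos.2 (by omega))
  unfold mixedWeight
  split_ifs
  · have := mul_nonneg (sub_nonneg.2 hδ1.le) ((hP n hn).1 j)
    positivity
  · exact hinv

/-- The pairs (base, digit) with base below `T` that have frequency zero in every point of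
`J_A(α)` because `P^α` gives them no mass. -/
noncomputable def negligiblePairs (d α : ℕ → ℝ) (T : ℕ) : Finset (ℕ × ℕ) :=
  open Classical in
  {p ∈ range T ×ˢ range T | p.2 < p.1 ∧ (d p.1 = 0 ∨ optMatrix d α p.1 p.2 = 0)}

theorem mem_negligiblePairs {T n j : ℕ} (hj : j < n) :
    (n, j) ∈ negligiblePairs d α T ↔ n < T ∧ (d n = 0 ∨ optMatrix d α n j = 0) := by
  simp only [negligiblePairs, Finset.mem_filter, Finset.mem_product, Finset.mem_range]
  constructor
  · tauto
  · exact fun h => ⟨⟨h.1, hj.trans h.1⟩, hj, h.2⟩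

theorem log_mixedWeight_ge (hα : IsStochastic α) (hd : IsBaseDistribution d)
    (hne : (admissible d α).Nonempty) (T : ℕ) {δ : ℝ} (hδ : 0 < δ) (hδ1 : δ < 1) {n j : ℕ}
    (hn : 2 ≤ n) (hj : j < n) (hnj : (n, j) ∉ negligiblePairs d α T) :
    (if n ∈ range T then Real.log n else 0) + Real.log (1 - δ) - digitLoss d α T j -
      baseLoss d α T n ≤ Real.log n + Real.log (mixedWeight (optMatrix d α) T δ n j) := by
  rw [mem_negligiblePairs hj] at hnj
  by_cases hnT : n < T
  · push Not at hnj
    obtain ⟨hdn, hopt⟩ := hnj hnT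
    have hopt_pos : 0 < optMatrix d α n j :=
      ((optMatrix_mem_stochMatrices hα.1 hd hne n hn).1 j).lt_of_ne' hopt
    have hle : Real.log ((1 - δ) * optMatrix d α n j) ≤
        Real.log (mixedWeight (optMatrix d α) T δ n j) := by
      rw [mixedWeight, if_pos hnT]
      exact Real.log_le_log (mul_pos (sub_pos.2 hδ1) hopt_pos)
        (le_add_of_nonneg_right (by positivity))
    rw [Real.log_mul (sub_pos.2 hδ1).ne' hopt] at hle
    rw [if_pos (Finset.mem_range.2 hnT)]
    linarith [digitLoss_add_baseLoss hd hne hnT hj hdn hopt]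
  · rw [if_neg (by simpa using hnT), mixedWeight, if_neg hnT, baseLoss, if_neg hnT, Real.log_inv]
    linarith [digitLoss_nonneg hα hd hne T j,
      Real.log_nonpos (sub_pos.2 hδ1).le (sub_le_self 1 hδ.le)]

theorem tendsto_average_digitLoss_add_baseLoss (hfreq : IsBaseFrequency b d)
    (heα : ∀ j, HasFrequency e j (α j)) (T : ℕ) :
    Tendsto (fun N : ℕ => (∑ i ∈ range N, (digitLoss d α T (e i) + baseLoss d α T (b i))) / (N : ℝ))
      atTop (𝓝 (lossBound d α T)) := by
  have hlim := (tendsto_average_of_hasFrequency (s := range T) (fun j _ => heα j)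
    (digitLoss d α T)).add (tendsto_average_of_hasFrequency (u := b) (s := range T)
    (fun n _ => hfreq n) (baseLoss d α T))
  refine hlim.congr fun N => ?_
  rw [← add_div, ← Finset.sum_add_distrib]
  congr 1
  refine Finset.sum_congr rfl fun i _ => ?_
  simp +contextual [digitLoss, baseLoss]

theorem eventually_sum_log_mixedWeight_ge (hb : ∀ i, 2 ≤ b i) (hfreq : IsBaseFrequency b d)
    (hd : IsBaseDistribution d) (hα : IsStochastic α) (hne : (admissible d α).Nonempty)
    (he : ∀ i, e i < b i) (heα : ∀ j, HasFrequency e j (α j)) (T : ℕ) {δ : ℝ} (hδ : 0 < δ)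
    (hδ1 : δ < 1) {κ : ℝ}
    (hκ : κ < ∑ n ∈ range T, d n * Real.log n + Real.log (1 - δ) - lossBound d α T) :
    ∀ᶠ N : ℕ in atTop, κ * N ≤
      ∑ i ∈ range N, (Real.log (b i) + Real.log (mixedWeight (optMatrix d α) T δ (b i) (e i))) := by
  let gain (p : ℕ × ℕ) : ℝ :=
    Real.log p.1 + Real.log (mixedWeight (optMatrix d α) T δ p.1 p.2)
  let lower (p : ℕ × ℕ) : ℝ := (if p.1 ∈ range T then Real.log p.1 else 0) + Real.log (1 - δ) -
    (digitLoss d α T p.2 + baseLoss d α T p.1)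
  have hpair : ∀ p ∈ negligiblePairs d α T, HasFrequency (fun i => (b i, e i)) p 0 := by
    rintro ⟨n, j⟩ hp
    have hj : j < n := (Finset.mem_filter.1 hp).2.1
    exact hasFrequency_pair_zero_of_optMatrix_eq_zero hfreq hd hne he heα hj
      ((mem_negligiblePairs hj).1 hp).2
  have hlim := (((tendsto_average_of_hasFrequency (u := b) (s := range T) (fun n _ => hfreq n)
    fun n => Real.log n).add_const (Real.log (1 - δ))).sub
    (tendsto_average_digitLoss_add_baseLoss hfreq heα T)).sub
    (tendsto_average_of_hasFrequency hpair fun p => lower p - gain p)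
  simp only [zero_mul, Finset.sum_const_zero, sub_zero] at hlim
  filter_upwards [hlim.eventually (lt_mem_nhds hκ), eventually_gt_atTop 0] with N hN hN_pos
  have hN0 : (0 : ℝ) < N := Nat.cast_pos.2 hN_pos
  let corrected (i : ℕ) : ℝ := lower (b i, e i) -
    if (b i, e i) ∈ negligiblePairs d α T then lower (b i, e i) - gain (b i, e i) else 0
  suffices haverage : κ < (∑ i ∈ range N, corrected i) / N by
    refine ((lt_div_iff₀ hN0).1 haverage).le.trans (Finset.sum_le_sum fun i _ => ?_)
    by_cases hp : (b i, e i) ∈ negligiblePairs d α T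
    · simp [corrected, gain, hp]
    · have := log_mixedWeight_ge hα hd hne T hδ hδ1 (hb i) (he i) hp
      simp only [corrected, lower, hp, if_false]
      linarith
  refine hN.trans_eq ?_
  simp only [corrected, lower, Finset.sum_sub_distrib, Finset.sum_add_distrib, Finset.sum_const,
    Finset.card_range, nsmul_eq_mul, sub_div, add_div]
  rw [mul_div_cancel_left₀ _ hN0.ne']

theorem dimH_le_of_sum_log_weight (hb : ∀ i, 2 ≤ b i) {E : Set ℝ} (hE : E ⊆ Set.Icc 0 1)
    {w : ℕ → ℕ → ℝ} (hw : ∀ i j, 0 < w i j) (hsum : ∀ i, ∑ j ∈ range (b i), w i j ≤ 1) {κ : ℝ}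
    (h : ∀ x ∈ E, ∀ᶠ N : ℕ in atTop, κ * N ≤
      ∑ i ∈ range N, (Real.log (b i) + Real.log (w i (digit b x i))))
    {s : NNReal} (hs : ∃ᶠ N : ℕ in atTop, (1 - s) * Real.log (baseProd b N) ≤ κ * N) :
    dimH E ≤ s := by
  let tail (N₀ : ℕ) : Set ℝ := {x | x ∈ E ∧ ∀ N ≥ N₀, κ * N ≤
    ∑ i ∈ range N, (Real.log (b i) + Real.log (w i (digit b x i)))}
  have hcover : E ⊆ ⋃ N₀, tail N₀ := fun x hx => by
    obtain ⟨N₀, hN₀⟩ := eventually_atTop.1 (h x hx)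
    exact Set.mem_iUnion.2 ⟨N₀, hx, hN₀⟩
  refine (dimH_mono hcover).trans ?_
  rw [dimH_iUnion]
  refine iSup_le fun N₀ => dimH_le_of_weight hb (fun x hx => hE hx.1) (fun i j => (hw i j).le) hsum
    ((hs.and_eventually (eventually_ge_atTop N₀)).mono ?_)
  rintro N ⟨hN, hN₀⟩ x hx
  have hgain := hx.2 N hN₀
  rw [Finset.sum_add_distrib, ← log_baseProd hb] at hgain
  rw [← Real.log_le_log_iff (Real.rpow_pos_of_pos (baseProd_pos hb N) _)
    (Finset.prod_pos fun i _ => hw i _), Real.log_rpow (baseProd_pos hb N),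
    Real.log_prod fun i _ => (hw i _).ne']
  linarith

theorem dimH_levelSet_le (hb : ∀ i, 2 ≤ b i) (hfreq : IsBaseFrequency b d)
    (hd : IsBaseDistribution d) (hα : IsStochastic α) (hne : (admissible d α).Nonempty)
    (hlog : Summable fun n : ℕ => d n * Real.log n) {κ : ℝ}
    (hκ : κ < ∑' n : ℕ, d n * Real.log n - ∑' n, d n * rowEntropy (optMatrix d α) n)
    {s : NNReal} (hs : ∃ᶠ N : ℕ in atTop, (1 - s) * Real.log (baseProd b N) ≤ κ * N) :
    dimH (levelSet b α) ≤ s := by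
  have hopt := optMatrix_mem_stochMatrices hα.1 hd hne
  set H := ∑' n : ℕ, d n * Real.log n
  set E := ∑' n, d n * rowEntropy (optMatrix d α) n
  obtain ⟨ε, hε, hκε⟩ : ∃ ε > 0, κ + 4 * ε = H - E := ⟨(H - E - κ) / 4, by linarith, by ring⟩
  obtain ⟨T, hloss, hpartial⟩ := ((eventually_lossBound_le hα hd hne hlog hε).and
    (hlog.hasSum.tendsto_sum_nat.eventually (lt_mem_nhds (sub_lt_self H hε)))).exists
  set δ : ℝ := 1 - Real.exp (-ε) with hδ_def
  have hδ : 0 < δ := sub_pos.2 (Real.exp_lt_one_iff.2 (neg_neg_of_pos hε))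
  have hδ1 : δ < 1 := sub_lt_self _ (Real.exp_pos _)
  have hlogδ : Real.log (1 - δ) = -ε := by rw [hδ_def, sub_sub_cancel, Real.log_exp]
  exact dimH_le_of_sum_log_weight hb (w := fun i => mixedWeight (optMatrix d α) T δ (b i))
    (fun x hx => hx.1) (fun i => mixedWeight_pos hopt T hδ hδ1 (hb i))
    (fun i => (sum_mixedWeight hopt T δ (hb i)).le)
    (fun x hx => eventually_sum_log_mixedWeight_ge hb hfreq hd hα hne (digit_lt hb x) hx.2 T hδ hδ1
      (by linarith)) hs

end UpperBound

section MassDistribution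

variable {X : Type*} [MetricSpace X] [MeasurableSpace X] {μ : Measure X} {C r₀ : ℝ}

theorem measure_singleton_eq_zero_of_closedBall_le {s : ℝ} (hs : 0 < s) (hr₀ : 0 < r₀) {x : X}
    (h : ∀ r ∈ Set.Ioc 0 r₀, μ (Metric.closedBall x r) ≤ ENNReal.ofReal (C * r ^ s)) :
    μ {x} = 0 := by
  have hlim : Tendsto (fun r : ℝ => ENNReal.ofReal (C * r ^ s)) (𝓝[>] 0) (𝓝 0) := by
    have hrpow := ((Real.continuousAt_rpow_const 0 s (Or.inr hs.le)).const_mul C).tendsto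
    rw [Real.zero_rpow hs.ne', mul_zero] at hrpow
    simpa using ENNReal.tendsto_ofReal (hrpow.mono_left nhdsWithin_le_nhds)
  refine le_antisymm (ge_of_tendsto hlim ?_) zero_le
  filter_upwards [Ioc_mem_nhdsGT hr₀] with r hr
  exact (measure_mono (Set.singleton_subset_iff.2 (Metric.mem_closedBall_self hr.1.le))).trans
    (h r hr)

theorem measure_le_mul_ediam_rpow {s : ℝ} (hs : 0 < s) (hr₀ : 0 < r₀)
    (h : ∀ x, ∀ r ∈ Set.Ioc 0 r₀, μ (Metric.closedBall x r) ≤ ENNReal.ofReal (C * r ^ s))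
    {U : Set X} (hU : Metric.ediam U ≤ ENNReal.ofReal r₀) :
    μ U ≤ ENNReal.ofReal C * Metric.ediam U ^ s := by
  rcases U.eq_empty_or_nonempty with rfl | ⟨x, hx⟩
  · simp
  rcases eq_or_ne (Metric.ediam U) 0 with hdiam | hdiam
  · have hsingleton : U = {x} :=
      Set.Subsingleton.eq_singleton_of_mem (Metric.ediam_eq_zero_iff.1 hdiam) hx
    rw [hsingleton, measure_singleton_eq_zero_of_closedBall_le hs hr₀ (h x)]
    exact zero_le
  · have hfin : Metric.ediam U ≠ ⊤ := ne_top_of_le_ne_top ENNReal.ofReal_ne_top hU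
    set r := (Metric.ediam U).toReal
    have hr : 0 < r := ENNReal.toReal_pos hdiam hfin
    have hr_eq : ENNReal.ofReal r = Metric.ediam U := ENNReal.ofReal_toReal hfin
    have hsub : U ⊆ Metric.closedBall x r := fun y hy => by
      have := Metric.edist_le_ediam_of_mem hy hx
      rwa [← hr_eq, edist_dist, ENNReal.ofReal_le_ofReal_iff hr.le] at this
    rw [← hr_eq, ENNReal.ofReal_rpow_of_pos hr, ← ENNReal.ofReal_mul' (by positivity)]
    exact (measure_mono hsub).trans (h x r ⟨hr, ENNReal.toReal_le_of_le_ofReal hr₀.le hU⟩)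

theorem le_dimH_of_closedBall_le [BorelSpace X] {s : NNReal} (hr₀ : 0 < r₀)
    (h : ∀ x, ∀ r ∈ Set.Ioc 0 r₀, μ (Metric.closedBall x r) ≤ ENNReal.ofReal (C * r ^ (s : ℝ)))
    {E : Set X} (hE : μ E ≠ 0) : (s : ENNReal) ≤ dimH E := by
  rcases eq_or_ne s 0 with rfl | hs
  · simp
  have hs' : (0 : ℝ) < s := NNReal.coe_pos.2 (pos_iff_ne_zero.2 hs)
  have hle : (ENNReal.ofReal C)⁻¹ • μ ≤ Measure.hausdorffMeasure (s : ℝ) := by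
    refine Measure.le_hausdorffMeasure _ _ _ (ENNReal.ofReal_pos.2 hr₀) fun U hU => ?_
    rw [Measure.smul_apply, smul_eq_mul, mul_comm, ← div_eq_mul_inv]
    exact ENNReal.div_le_of_le_mul' (measure_le_mul_ediam_rpow hs' hr₀ h hU)
  refine le_dimH_of_hausdorffMeasure_ne_zero (((hle E).trans_lt' ?_).ne')
  rw [Measure.smul_apply, smul_eq_mul]
  exact pos_iff_ne_zero.2 (mul_ne_zero (by simp) hE)

end MassDistribution

section CantorMeasure

variable {b e : ℕ → ℕ}

/-- The index of the cylinder of order `N` given by the digits `e`, the cylinders of order `N`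
being numbered `0, 1, …, b 0 ⋯ b (N - 1) - 1` from left to right. -/
def cylinderIndex (b e : ℕ → ℕ) : ℕ → ℕ
  | 0 => 0
  | N + 1 => cylinderIndex b e N * b N + e N

theorem sum_digits_eq_cylinderIndex_div (hb : ∀ i, 2 ≤ b i) (e : ℕ → ℕ) (N : ℕ) :
    ∑ i ∈ range N, (e i : ℝ) / baseProd b (i + 1) = cylinderIndex b e N / baseProd b N := by
  induction N with
  | zero => simp [cylinderIndex]
  | succ N ih =>
    rw [Finset.sum_range_succ, ih, cylinderIndex, baseProd_succ]
    have hprod := (baseProd_pos hb N).ne'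
    have hbase := (base_pos hb N).ne'
    push_cast
    field_simp

theorem cylinderIndex_le_cantorValue_mul (hb : ∀ i, 2 ≤ b i) (he : ∀ i, e i < b i) (N : ℕ) :
    (cylinderIndex b e N : ℝ) ≤ cantorValue b e * baseProd b N := by
  rw [← div_le_iff₀ (baseProd_pos hb N), ← sum_digits_eq_cylinderIndex_div hb]
  exact sum_range_le_cantorValue hb he N

theorem cantorValue_mul_le_cylinderIndex_add_one (hb : ∀ i, 2 ≤ b i) (he : ∀ i, e i < b i)
    (N : ℕ) : cantorValue b e * baseProd b N ≤ cylinderIndex b e N + 1 := by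
  rw [← le_div_iff₀ (baseProd_pos hb N), add_div, ← sum_digits_eq_cylinderIndex_div hb]
  exact cantorValue_le hb he N

theorem cantorValue_mul_lt_cylinderIndex_add_one (hb : ∀ i, 2 ≤ b i) (he : ∀ i, e i < b i)
    (hfr : ∃ᶠ i in atTop, e i + 1 < b i) (N : ℕ) :
    cantorValue b e * baseProd b N < cylinderIndex b e N + 1 := by
  obtain ⟨n, hn, hNn⟩ := (hfr.and_eventually (eventually_ge_atTop N)).exists
  rw [← lt_div_iff₀ (baseProd_pos hb N), add_div, ← sum_digits_eq_cylinderIndex_div hb]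
  refine (cantorValue_le hb he (n + 1)).trans_lt ?_
  have hprefix := sum_Ico_digits_le hb he hNn
  rw [Finset.sum_range_succ, ← Finset.sum_range_add_sum_Ico _ hNn]
  have hdigit : (e n : ℝ) / baseProd b (n + 1) + 1 / baseProd b (n + 1) < 1 / baseProd b n := by
    have hlt : (e n : ℝ) + 1 < b n := by exact_mod_cast hn
    have hprod := baseProd_pos hb n
    have hbase := base_pos hb n
    rw [← add_div, baseProd_succ, Nat.cast_mul, div_lt_div_iff₀ (by positivity) hprod, one_mul,
      mul_comm]
    gcongr
  linarith

theorem eq_of_cylinderIndex_eq {e' : ℕ → ℕ} (he : ∀ i, e i < b i) (he' : ∀ i, e' i < b i)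
    {N : ℕ} (h : cylinderIndex b e N = cylinderIndex b e' N) : ∀ i < N, e i = e' i := by
  induction N with
  | zero => exact fun i hi => absurd hi i.not_lt_zero
  | succ N ih =>
    rw [cylinderIndex, cylinderIndex] at h
    have hlast : e N = e' N := by
      rw [← Nat.mul_add_mod_of_lt (he N), h, Nat.mul_add_mod_of_lt (he' N)]
    rw [hlast, Nat.add_right_cancel_iff] at h
    have hprefix := ih (Nat.eq_of_mul_eq_mul_right ((Nat.zero_le _).trans_lt (he N)) h)
    intro i hi
    rcases Nat.lt_succ_iff_lt_or_eq.1 hi with hiN | rfl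
    · exact hprefix i hiN
    · exact hlast

theorem cantorValue_mem_Ico (hb : ∀ i, 2 ≤ b i) (he : ∀ i, e i < b i)
    (hfr : ∃ᶠ i in atTop, e i + 1 < b i) : cantorValue b e ∈ Set.Ico (0 : ℝ) 1 := by
  have hge := cylinderIndex_le_cantorValue_mul hb he 0
  have hlt := cantorValue_mul_lt_cylinderIndex_add_one hb he hfr 0
  simp only [cylinderIndex, baseProd, Finset.prod_range_zero, Nat.cast_zero, Nat.cast_one, mul_one,
    zero_add] at hge hlt
  exact ⟨hge, hlt⟩

theorem digit_cantorValue (hb : ∀ i, 2 ≤ b i) (he : ∀ i, e i < b i)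
    (hfr : ∃ᶠ i in atTop, e i + 1 < b i) : digit b (cantorValue b e) = e := by
  funext i
  have hge := cylinderIndex_le_cantorValue_mul hb he (i + 1)
  have hfloor : ⌊cantorValue b e * baseProd b (i + 1)⌋₊ = cylinderIndex b e (i + 1) :=
    (Nat.floor_eq_iff ((Nat.cast_nonneg _).trans hge)).2
      ⟨hge, cantorValue_mul_lt_cylinderIndex_add_one hb he hfr (i + 1)⟩
  rw [digit, if_neg (cantorValue_mem_Ico hb he hfr).2.ne, ← baseProd, hfloor, cylinderIndex,
    Nat.mul_add_mod_of_lt (he i)]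

theorem measurable_cantorValue (b : ℕ → ℕ) : Measurable (cantorValue b) := by
  have heq (e : ℕ → ℕ) : cantorValue b e =
      (∑' i, ENNReal.ofReal ((e i : ℝ) / baseProd b (i + 1))).toReal := by
    rw [ENNReal.tsum_toReal_eq fun i => ENNReal.ofReal_ne_top]
    exact tsum_congr fun i => (ENNReal.toReal_ofReal (by positivity)).symm
  rw [funext heq]
  fun_prop

theorem countable_setOf_eventually_eq (c : ℕ → ℕ) :
    {e : ℕ → ℕ | ∀ᶠ i in atTop, e i = c i}.Countable := by
  have hcover : {e : ℕ → ℕ | ∀ᶠ i in atTop, e i = c i} ⊆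
      ⋃ K : ℕ, Set.range fun v : Fin K → ℕ => fun i => if h : i < K then v ⟨i, h⟩ else c i := by
    intro e he
    obtain ⟨K, hK⟩ := eventually_atTop.1 he
    refine Set.mem_iUnion.2 ⟨K, fun i => e i, funext fun i => ?_⟩
    beta_reduce
    split_ifs with h
    · rfl
    · exact (hK i (not_lt.1 h)).symm
  exact (Set.countable_iUnion fun K => Set.countable_range _).mono hcover

theorem card_Icc_ceil_floor_le {u v : ℝ} (h : u ≤ v + 1) :
    (#(Finset.Icc ⌈u⌉ ⌊v⌋) : ℝ) ≤ v - u + 1 := by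
  rw [Int.card_Icc, ← Int.cast_natCast, Int.toNat_eq_max, Int.cast_max]
  push_cast
  exact max_le (by linarith [Int.floor_le v, Int.le_ceil u]) (by linarith)

variable {ν : ℕ → Measure ℕ} [∀ i, IsProbabilityMeasure (ν i)] {G : Set (ℕ → ℕ)}

theorem infinitePi_cylinder_le (hGb : ∀ e ∈ G, ∀ i, e i < b i) {N : ℕ} {c : ENNReal}
    (hcyl : ∀ e ∈ G, ∏ i ∈ range N, ν i {e i} ≤ c) (a : ℤ) :
    Measure.infinitePi ν {e ∈ G | (cylinderIndex b e N : ℤ) = a} ≤ c := by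
  rcases Set.eq_empty_or_nonempty {e ∈ G | (cylinderIndex b e N : ℤ) = a} with
    hempty | ⟨e, heG, hea⟩
  · simp [hempty]
  refine le_trans ?_ (hcyl e heG)
  rw [← Measure.infinitePi_pi ν (s := range N) (t := fun i => {e i})
    fun i _ => measurableSet_singleton _]
  refine measure_mono ?_
  rintro e' ⟨heG', hea'⟩ i hi
  exact eq_of_cylinderIndex_eq (hGb e' heG') (hGb e heG)
    (Nat.cast_injective (R := ℤ) (hea'.trans hea.symm)) i (Finset.mem_range.1 hi)

theorem infinitePi_cantorValue_mem_closedBall_le (hb : ∀ i, 2 ≤ b i)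
    (hGb : ∀ e ∈ G, ∀ i, e i < b i) {N : ℕ} {c : ENNReal}
    (hcyl : ∀ e ∈ G, ∏ i ∈ range N, ν i {e i} ≤ c) (x : ℝ) {r : ℝ} (hr : 1 ≤ r * baseProd b N) :
    Measure.infinitePi ν {e ∈ G | cantorValue b e ∈ Metric.closedBall x r} ≤
      ENNReal.ofReal (4 * (r * baseProd b N)) * c := by
  set q : ℝ := (baseProd b N : ℝ)
  have hq : 0 < q := baseProd_pos hb N
  set I : Finset ℤ := Finset.Icc ⌈(x - r) * q - 1⌉ ⌊(x + r) * q⌋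
  have hcover : {e ∈ G | cantorValue b e ∈ Metric.closedBall x r} ⊆
      ⋃ a ∈ I, {e ∈ G | (cylinderIndex b e N : ℤ) = a} := by
    rintro e ⟨he, hx⟩
    refine Set.mem_biUnion (x := (cylinderIndex b e N : ℤ)) ?_ ⟨he, rfl⟩
    rw [Metric.mem_closedBall, Real.dist_eq, abs_le] at hx
    have hleft : (x - r) * q ≤ cantorValue b e * q :=
      mul_le_mul_of_nonneg_right (by linarith) hq.le
    have hright : cantorValue b e * q ≤ (x + r) * q :=
      mul_le_mul_of_nonneg_right (by linarith) hq.le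
    rw [Finset.mem_coe, Finset.mem_Icc, Int.ceil_le, Int.le_floor, Int.cast_natCast]
    exact ⟨by linarith [cantorValue_mul_le_cylinderIndex_add_one hb (hGb e he) N],
      (cylinderIndex_le_cantorValue_mul hb (hGb e he) N).trans hright⟩
  have hcard : (#I : ℝ) ≤ 4 * (r * q) :=
    (card_Icc_ceil_floor_le (by linarith)).trans (by linarith)
  calc Measure.infinitePi ν {e ∈ G | cantorValue b e ∈ Metric.closedBall x r}
      ≤ ∑ a ∈ I, Measure.infinitePi ν {e ∈ G | (cylinderIndex b e N : ℤ) = a} :=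
        (measure_mono hcover).trans (measure_biUnion_finset_le _ _)
    _ ≤ #I • c := Finset.sum_le_card_nsmul _ _ _ fun a _ => infinitePi_cylinder_le hGb hcyl a
    _ ≤ ENNReal.ofReal (4 * (r * q)) * c := by
        rw [nsmul_eq_mul, ← ENNReal.ofReal_natCast]
        gcongr

theorem exists_one_div_baseProd_lt_le (hb : ∀ i, 2 ≤ b i) {N₀ : ℕ} {r : ℝ} (hr : 0 < r)
    (hrN₀ : r ≤ 1 / baseProd b N₀) :
    ∃ N ≥ N₀, 1 / (baseProd b (N + 1) : ℝ) < r ∧ r ≤ 1 / baseProd b N := by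
  by_contra! h
  have hle : ∀ N ≥ N₀, r ≤ 1 / baseProd b N := fun N hN => by
    induction N, hN using Nat.le_induction with
    | base => exact hrN₀
    | succ N hN ih => exact not_lt.1 fun hlt => (h N hN hlt).not_ge ih
  exact hr.not_ge (ge_of_tendsto (tendsto_one_div_baseProd hb)
    (eventually_atTop.2 ⟨N₀, hle⟩))

theorem mul_baseProd_succ_mul_le_rpow (hb : ∀ i, 2 ≤ b i) {N : ℕ} {r s : ℝ} (hr : 0 < r)
    (hrN : r ≤ 1 / baseProd b N) (hs : s ≤ 1) :
    r * baseProd b (N + 1) * ((baseProd b N : ℝ) ^ (-s) / b N) ≤ r ^ s := by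
  have hprod := baseProd_pos hb N
  have hbase := (base_pos hb N).ne'
  calc r * baseProd b (N + 1) * ((baseProd b N : ℝ) ^ (-s) / b N)
      = r * (baseProd b N : ℝ) ^ (1 - s) := by
        rw [baseProd_succ, sub_eq_add_neg, Real.rpow_add hprod, Real.rpow_one, Nat.cast_mul]
        field_simp
    _ ≤ r * (1 / r) ^ (1 - s) := by
        have : (baseProd b N : ℝ) ≤ 1 / r := (le_div_comm₀ hr hprod).1 hrN
        gcongr
    _ = r ^ s := by
        rw [one_div, Real.inv_rpow hr.le, ← Real.rpow_neg hr.le, neg_sub, Real.rpow_sub_one hr.ne',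
          mul_div_cancel₀ _ hr.ne']

theorem measure_eq_zero_of_map_cantorValue (hb : ∀ i, 2 ≤ b i) {M : Measure (ℕ → ℕ)}
    {G : Set (ℕ → ℕ)} (hGb : ∀ e ∈ G, ∀ i, e i < b i)
    (hatom : ∀ x, M.map (cantorValue b) {x} = 0)
    (hzero : M.map (cantorValue b) {x | x ∈ Set.Icc (0 : ℝ) 1 ∧ digit b x ∈ G} = 0) :
    M G = 0 := by
  have hmeas := (measurable_cantorValue b).aemeasurable (μ := M)
  have hlast : M {e | ∀ᶠ i in atTop, e i = b i - 1} = 0 := by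
    rw [← Set.biUnion_of_singleton {e : ℕ → ℕ | ∀ᶠ i in atTop, e i = b i - 1},
      measure_biUnion_null_iff (countable_setOf_eventually_eq _)]
    intro e _
    have hfibre : M (cantorValue b ⁻¹' {cantorValue b e}) = 0 :=
      nonpos_iff_eq_zero.1 ((Measure.le_map_apply hmeas _).trans_eq (hatom _))
    exact measure_mono_null (by simp : ({e} : Set (ℕ → ℕ)) ⊆ _) hfibre
  refine measure_mono_null ?_ (measure_union_null hlast
    (nonpos_iff_eq_zero.1 ((Measure.le_map_apply hmeas _).trans_eq hzero)))
  intro e he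
  rw [Set.mem_union, or_iff_not_imp_left]
  intro hnot
  have hfr : ∃ᶠ i in atTop, e i + 1 < b i :=
    (not_eventually.1 hnot).mono fun i hi => by have := hGb e he i; omega
  rw [Set.mem_preimage, Set.mem_ofPred_eq, digit_cantorValue hb (hGb e he) hfr]
  exact ⟨Set.Ico_subset_Icc_self (cantorValue_mem_Ico hb (hGb e he) hfr), he⟩

theorem le_dimH_of_cylinder_le (hb : ∀ i, 2 ≤ b i)
    (hG_pos : Measure.infinitePi ν G ≠ 0) (hGb : ∀ e ∈ G, ∀ i, e i < b i) {s : NNReal}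
    (hs : s ≤ 1) {N₀ : ℕ}
    (hcyl : ∀ e ∈ G, ∀ N ≥ N₀, ∏ i ∈ range (N + 1), ν i {e i} ≤
      ENNReal.ofReal ((baseProd b N : ℝ) ^ (-(s : ℝ)) / b N)) :
    (s : ENNReal) ≤ dimH {x | x ∈ Set.Icc (0 : ℝ) 1 ∧ digit b x ∈ G} := by
  rcases eq_or_ne s 0 with rfl | hs0
  · simp
  set M := Measure.infinitePi ν
  have hmeas := measurable_cantorValue b
  set μ : Measure ℝ := (M.restrict G).map (cantorValue b) with hμ
  have hr₀ : 0 < 1 / (baseProd b N₀ : ℝ) := one_div_pos.2 (baseProd_pos hb N₀)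
  have hball (x r : ℝ) (hr : r ∈ Set.Ioc 0 (1 / (baseProd b N₀ : ℝ))) :
      μ (Metric.closedBall x r) ≤ ENNReal.ofReal (4 * r ^ (s : ℝ)) := by
    obtain ⟨N, hN, hlt, hle⟩ := exists_one_div_baseProd_lt_le hb hr.1 hr.2
    have hrq : 1 ≤ r * baseProd b (N + 1) := ((div_lt_iff₀ (baseProd_pos hb _)).1 hlt).le
    have hpreimage := hmeas (measurableSet_closedBall (x := x) (ε := r))
    rw [hμ, Measure.map_apply hmeas measurableSet_closedBall, Measure.restrict_apply hpreimage,
      Set.inter_comm]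
    refine (infinitePi_cantorValue_mem_closedBall_le hb hGb (fun e he => hcyl e he N hN) x
      hrq).trans ?_
    rw [← ENNReal.ofReal_mul (by linarith), mul_assoc]
    exact ENNReal.ofReal_le_ofReal
      (mul_le_mul_of_nonneg_left (mul_baseProd_succ_mul_le_rpow hb hr.1 hle hs) (by norm_num))
  refine le_dimH_of_closedBall_le hr₀ hball fun hzero => hG_pos ?_
  rw [← Measure.restrict_apply_self M G]
  exact measure_eq_zero_of_map_cantorValue hb hGb (fun x =>
    measure_singleton_eq_zero_of_closedBall_le (NNReal.coe_pos.2 (pos_iff_ne_zero.2 hs0)) hr₀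
      (hball x)) hzero

end CantorMeasure

section LawOfLargeNumbers

variable {Ω : Type*} [MeasurableSpace Ω] {μ : Measure Ω} {X : ℕ → Ω → ℝ} {c : NNReal}

theorem ae_eventually_sum_lt_of_hasSubgaussianMGF (hind : iIndepFun X μ)
    (hX : ∀ i, HasSubgaussianMGF (X i) c μ) (hc : 0 < c) {ε : ℝ} (hε : 0 < ε) :
    ∀ᵐ ω ∂μ, ∀ᶠ N : ℕ in atTop, ∑ i ∈ range N, X i ω < ε * N := by
  have := hind.isProbabilityMeasure
  have htail (N : ℕ) : μ {ω | ε * N ≤ ∑ i ∈ range N, X i ω} ≤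
      ENNReal.ofReal (Real.exp (-(ε ^ 2 / (2 * c))) ^ N) := by
    rw [← ofReal_measureReal]
    refine ENNReal.ofReal_le_ofReal ((HasSubgaussianMGF.measure_sum_range_ge_le_of_iIndepFun hind
      (fun i _ => hX i) (by positivity)).trans_eq ?_)
    rw [← Real.exp_nat_mul]
    rcases N.eq_zero_or_pos with rfl | hN
    · simp
    · congr 1
      field_simp
  have hgeom : Summable fun N : ℕ => Real.exp (-(ε ^ 2 / (2 * c))) ^ N :=
    summable_geometric_of_lt_one (Real.exp_pos _).le
      (Real.exp_lt_one_iff.2 (neg_neg_of_pos (by positivity)))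
  have hsum : ∑' N : ℕ, μ {ω | ε * N ≤ ∑ i ∈ range N, X i ω} ≠ ⊤ :=
    ne_top_of_le_ne_top hgeom.tsum_ofReal_ne_top (ENNReal.tsum_le_tsum htail)
  filter_upwards [ae_eventually_notMem hsum] with ω hω
  filter_upwards [hω] with N hN using not_le.1 hN

theorem ae_tendsto_average_of_hasSubgaussianMGF (hind : iIndepFun X μ)
    (hX : ∀ i, HasSubgaussianMGF (X i) c μ) :
    ∀ᵐ ω ∂μ, Tendsto (fun N : ℕ => (∑ i ∈ range N, X i ω) / N) atTop (𝓝 0) := by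
  rcases eq_zero_or_pos c with rfl | hc
  · filter_upwards [ae_all_iff.2 fun i => (hX i).ae_eq_zero_of_hasSubgaussianMGF_zero] with ω hω
    simp [hω]
  have hupper : ∀ᵐ ω ∂μ, ∀ m : ℕ, ∀ᶠ N : ℕ in atTop,
      ∑ i ∈ range N, X i ω < 1 / (m + 1 : ℝ) * N :=
    ae_all_iff.2 fun m => ae_eventually_sum_lt_of_hasSubgaussianMGF hind hX hc (by positivity)
  have hlower : ∀ᵐ ω ∂μ, ∀ m : ℕ, ∀ᶠ N : ℕ in atTop,
      ∑ i ∈ range N, (-X i) ω < 1 / (m + 1 : ℝ) * N :=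
    ae_all_iff.2 fun m => ae_eventually_sum_lt_of_hasSubgaussianMGF
      (hind.comp (fun _ => Neg.neg) fun _ => measurable_neg) (fun i => (hX i).neg) hc
      (by positivity)
  filter_upwards [hupper, hlower] with ω hω_upper hω_lower
  refine Metric.tendsto_nhds.2 fun ε hε => ?_
  obtain ⟨m, hm⟩ := exists_nat_one_div_lt hε
  filter_upwards [hω_upper m, hω_lower m, eventually_gt_atTop 0] with N hN_upper hN_lower hN
  have hN' : (0 : ℝ) < N := Nat.cast_pos.2 hN
  have hmN : 1 / (m + 1 : ℝ) * N < ε * N := mul_lt_mul_of_pos_right hm hN'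
  simp only [Pi.neg_apply, Finset.sum_neg_distrib] at hN_lower
  rw [dist_zero_right, Real.norm_eq_abs, abs_div, abs_of_pos hN', div_lt_iff₀ hN', abs_lt]
  constructor <;> linarith

theorem ae_infinitePi_tendsto_average {Ω : ℕ → Type*} [∀ i, MeasurableSpace (Ω i)]
    (ν : ∀ i, Measure (Ω i)) [∀ i, IsProbabilityMeasure (ν i)] {f : ∀ i, Ω i → ℝ}
    (hf : ∀ i, Measurable (f i)) {u v : ℝ} (huv : ∀ i x, f i x ∈ Set.Icc u v) :
    ∀ᵐ ω ∂Measure.infinitePi ν,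
      Tendsto (fun N : ℕ => (∑ i ∈ range N, (f i (ω i) - ∫ x, f i x ∂ν i)) / N) atTop (𝓝 0) := by
  refine ae_tendsto_average_of_hasSubgaussianMGF (c := (‖v - u‖₊ / 2) ^ 2)
    (iIndepFun_infinitePi (X := fun i x => f i x - ∫ y, f i y ∂ν i)
      fun i => (hf i).sub_const _) fun i => ?_
  refine .of_map (Y := fun ω : ∀ i, Ω i => ω i) (X := fun x => f i x - ∫ y, f i y ∂ν i)
    (measurable_pi_apply i).aemeasurable ?_
  rw [Measure.infinitePi_map_eval]
  exact hasSubgaussianMGF_of_mem_Icc (hf i).aemeasurable (.of_forall (huv i))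

end LawOfLargeNumbers

theorem exists_monotone_tendsto_atTop_of_forall_eventually {p : ℕ → ℕ → Prop}
    (h : ∀ k, ∀ᶠ N in atTop, p k N) :
    ∃ m : ℕ → ℕ, Monotone m ∧ Tendsto m atTop atTop ∧ ∀ᶠ N in atTop, p (m N) N := by
  choose f hf using fun k => eventually_atTop.1 (h k)
  set g : ℕ → ℕ := fun k => k + ∑ i ∈ range (k + 1), f i
  have hfg (k : ℕ) : f k ≤ g k :=
    (Finset.single_le_sum (fun _ _ => Nat.zero_le _) (Finset.self_mem_range_succ k)).trans
      (Nat.le_add_left _ _)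
  set m : ℕ → ℕ := fun N => Nat.findGreatest (fun k => g k ≤ N) N
  have hspec {N : ℕ} (hN : m N ≠ 0) : g (m N) ≤ N :=
    Nat.findGreatest_of_ne_zero (P := fun k => g k ≤ N) rfl hN
  have hle {N k : ℕ} (hk : g k ≤ N) : k ≤ m N :=
    Nat.le_findGreatest ((Nat.le_add_right _ _).trans hk) hk
  have hlim : Tendsto m atTop atTop :=
    tendsto_atTop.2 fun k => (eventually_ge_atTop (g k)).mono fun N => hle
  refine ⟨m, fun N N' hN => ?_, hlim, ?_⟩
  · rcases eq_or_ne (m N) 0 with hm | hm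
    · exact hm.le.trans (Nat.zero_le _)
    · exact hle ((hspec hm).trans hN)
  · filter_upwards [hlim.eventually_ne_atTop 0] with N hN
    exact hf _ _ ((hfg _).trans (hspec hN))

section DigitMeasure

variable {b : ℕ → ℕ} {d : ℕ → ℝ} {P : ℕ → ℕ → ℝ}

/-- The matrix `P` with its rows beyond the row `m` replaced by uniform rows. -/
noncomputable def uniformTail (P : ℕ → ℕ → ℝ) (m n j : ℕ) : ℝ :=
  if n ≤ m then P n j else if j < n then (n : ℝ)⁻¹ else 0

theorem uniformTail_mem_stochMatrices (hP : P ∈ stochMatrices) (m : ℕ) :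
    uniformTail P m ∈ stochMatrices := by
  intro n hn
  by_cases hnm : n ≤ m
  · simpa only [uniformTail, if_pos hnm] using hP n hn
  · simp only [uniformTail, if_neg hnm]
    refine ⟨fun j => by positivity, fun j hj => if_neg hj.not_gt, ?_⟩
    rw [Finset.sum_congr rfl fun j hj => if_pos (Finset.mem_range.1 hj), Finset.sum_const,
      Finset.card_range, nsmul_eq_mul, mul_inv_cancel₀ (by positivity)]

theorem lt_of_entry_pos (hP : P ∈ stochMatrices) {n j : ℕ} (hn : 2 ≤ n) (hpos : 0 < P n j) :
    j < n := by
  by_contra! hj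
  exact hpos.ne' ((hP n hn).2.1 j hj)

theorem log_add_log_uniformTail_le (hP : P ∈ stochMatrices) {K m n j : ℕ} (hn : 2 ≤ n)
    (hKm : K ≤ m) (hpos : 0 < uniformTail P m n j) :
    Real.log n + Real.log (uniformTail P m n j) ≤
      (if n < K then Real.log (P n j) else 0) + if n ≤ m then Real.log n else 0 := by
  by_cases hnm : n ≤ m
  · have hlog := Real.log_nonpos hpos.le (entry_le_one (uniformTail_mem_stochMatrices hP m) hn j)
    simp only [uniformTail, if_pos hnm] at hlog ⊢
    split_ifs <;> linarith
  · have hj := lt_of_entry_pos (uniformTail_mem_stochMatrices hP m) hn hpos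
    rw [uniformTail, if_neg hnm, if_pos hj, if_neg (by omega), if_neg hnm, Real.log_inv,
      add_neg_cancel, add_zero]

/-- The probability measure on the digits `0, …, n - 1` given by the row `n` of a matrix. -/
noncomputable def rowLaw (hP : P ∈ stochMatrices) {n : ℕ} (hn : 2 ≤ n) : PMF ℕ :=
  PMF.ofFinset (fun j => ENNReal.ofReal (P n j)) (range n)
    (by rw [← ENNReal.ofReal_sum_of_nonneg fun j _ => (hP n hn).1 j, (hP n hn).2.2,
      ENNReal.ofReal_one])
    fun j hj => by rw [(hP n hn).2.1 j (by simpa using hj), ENNReal.ofReal_zero]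

theorem rowLaw_toMeasure_singleton (hP : P ∈ stochMatrices) {n : ℕ} (hn : 2 ≤ n) (j : ℕ) :
    (rowLaw hP hn).toMeasure {j} = ENNReal.ofReal (P n j) :=
  PMF.toMeasure_apply_singleton _ _ (measurableSet_singleton j)

theorem ae_rowLaw_pos (hP : P ∈ stochMatrices) {n : ℕ} (hn : 2 ≤ n) :
    ∀ᵐ j ∂(rowLaw hP hn).toMeasure, 0 < P n j := by
  refine ae_iff_of_countable.2 fun j hj => ?_
  rwa [rowLaw_toMeasure_singleton, ENNReal.ofReal_ne_zero_iff] at hj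

/-- The law of independent digits of which the `i`-th is drawn from the row `b i` of `P` if
`b i ≤ m i`, and uniformly otherwise. -/
noncomputable def digitMeasure (hb : ∀ i, 2 ≤ b i) (hP : P ∈ stochMatrices) (m : ℕ → ℕ) :
    Measure (ℕ → ℕ) :=
  Measure.infinitePi fun i => (rowLaw (uniformTail_mem_stochMatrices hP (m i)) (hb i)).toMeasure

instance (hb : ∀ i, 2 ≤ b i) (hP : P ∈ stochMatrices) (m : ℕ → ℕ) :
    IsProbabilityMeasure (digitMeasure hb hP m) := by
  unfold digitMeasure
  infer_instance

theorem ae_digitMeasure_pos (hb : ∀ i, 2 ≤ b i) (hP : P ∈ stochMatrices) (m : ℕ → ℕ) :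
    ∀ᵐ e ∂digitMeasure hb hP m, ∀ i, 0 < uniformTail P (m i) (b i) (e i) := by
  refine ae_all_iff.2 fun i => ?_
  have hrow := ae_rowLaw_pos (uniformTail_mem_stochMatrices hP (m i)) (hb i)
  rw [← Measure.infinitePi_map_eval
    (fun i => (rowLaw (uniformTail_mem_stochMatrices hP (m i)) (hb i)).toMeasure) i] at hrow
  exact ae_of_ae_map (measurable_pi_apply i).aemeasurable hrow

theorem ae_digitMeasure_hasFrequency (hb : ∀ i, 2 ≤ b i) (hfreq : IsBaseFrequency b d)
    (hP : P ∈ stochMatrices) {m : ℕ → ℕ} (hm : Tendsto m atTop atTop) :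
    ∀ᵐ e ∂digitMeasure hb hP m,
      ∀ n j, HasFrequency (fun i => (b i, e i)) (n, j) (d n * P n j) := by
  refine ae_all_iff.2 fun n => ae_all_iff.2 fun j => ?_
  let count (i k : ℕ) : ℝ := if b i = n then ({j} : Set ℕ).indicator 1 k else 0
  have hcount (i k : ℕ) : count i k ∈ Set.Icc (0 : ℝ) 1 := by
    simp only [count, Set.indicator_apply]
    split_ifs <;> simp
  have hint (i : ℕ) :
      ∫ k, count i k ∂(rowLaw (uniformTail_mem_stochMatrices hP (m i)) (hb i)).toMeasure =
        if b i = n then uniformTail P (m i) n j else 0 := by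
    by_cases hi : b i = n
    · simp only [count, if_pos hi]
      rw [integral_indicator_one (measurableSet_singleton j), Measure.real,
        rowLaw_toMeasure_singleton, hi,
        ENNReal.toReal_ofReal ((uniformTail_mem_stochMatrices hP _ n (hi ▸ hb i)).1 j)]
    · simp [count, hi]
  filter_upwards [ae_infinitePi_tendsto_average
    (fun i => (rowLaw (uniformTail_mem_stochMatrices hP (m i)) (hb i)).toMeasure)
    (fun i => measurable_of_countable (count i)) hcount] with e he
  have hcorrection : Tendsto (fun i => if b i = n then uniformTail P (m i) n j - P n j else 0)
      atTop (𝓝 0) := by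
    refine tendsto_const_nhds.congr' ?_
    filter_upwards [hm.eventually_ge_atTop n] with i hi
    simp [uniformTail, hi]
  have hlim := (he.add hcorrection.cesaro).add ((hfreq n).mul_const (P n j))
  rw [zero_add, zero_add] at hlim
  refine hlim.congr fun N => ?_
  rw [occurrences, baseCount, Finset.card_filter, Finset.card_filter, inv_mul_eq_div,
    div_mul_eq_mul_div, ← add_div, ← add_div]
  push_cast
  rw [Finset.sum_mul, ← Finset.sum_add_distrib, ← Finset.sum_add_distrib]
  congr 1
  refine Finset.sum_congr rfl fun i _ => ?_
  rw [hint]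
  by_cases hi : b i = n
  · simp only [count, hi, if_true, Set.indicator_apply, Set.mem_singleton_iff, Pi.one_apply,
      Prod.mk.injEq, true_and, one_mul]
    ring
  · simp [count, hi]

theorem prod_le_rpow_div_of_sum_log_le (hb : ∀ i, 2 ≤ b i) {w : ℕ → ℝ} (hw : ∀ i, 0 < w i)
    {N : ℕ} {s : ℝ} (h : ∑ i ∈ range (N + 1), (Real.log (b i) + Real.log (w i)) ≤
      (1 - s) * Real.log (baseProd b N)) :
    ∏ i ∈ range (N + 1), w i ≤ (baseProd b N : ℝ) ^ (-s) / b N := by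
  have hprod := baseProd_pos hb N
  have hbase := base_pos hb N
  rw [← Real.log_le_log_iff (Finset.prod_pos fun i _ => hw i) (by positivity),
    Real.log_div (by positivity) hbase.ne', Real.log_rpow hprod,
    Real.log_prod fun i _ => (hw i).ne']
  rw [Finset.sum_add_distrib, Finset.sum_range_succ (fun i => Real.log (b i)),
    ← log_baseProd hb] at h
  linarith

theorem exists_measure_ne_zero_of_ae_eventually {Ω : Type*} [MeasurableSpace Ω] {μ : Measure Ω}
    [NeZero μ] {p : Ω → ℕ → Prop} (h : ∀ᵐ ω ∂μ, ∀ᶠ N in atTop, p ω N) :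
    ∃ N₀, μ {ω | ∀ N ≥ N₀, p ω N} ≠ 0 := by
  by_contra! hnull
  have hnever : ∀ᵐ ω ∂μ, ∀ N₀, ¬ ∀ N ≥ N₀, p ω N :=
    ae_all_iff.2 fun N₀ => by simpa only [ae_iff, not_not] using hnull N₀
  obtain ⟨ω, hω, hω_never⟩ := (h.and hnever).exists
  obtain ⟨N₀, hN₀⟩ := eventually_atTop.1 hω
  exact hω_never N₀ hN₀

theorem le_dimH_jointLevelSet (hb : ∀ i, 2 ≤ b i) (hfreq : IsBaseFrequency b d)
    (hP : P ∈ stochMatrices) {m : ℕ → ℕ} (hm : Tendsto m atTop atTop) {s : NNReal} (hs : s ≤ 1)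
    (h : ∀ e : ℕ → ℕ, (∀ i, 0 < uniformTail P (m i) (b i) (e i)) →
      (∀ n j, HasFrequency (fun i => (b i, e i)) (n, j) (d n * P n j)) →
      ∀ᶠ N in atTop, ∑ i ∈ range (N + 1), (Real.log (b i) +
        Real.log (uniformTail P (m i) (b i) (e i))) ≤ (1 - s) * Real.log (baseProd b N)) :
    (s : ENNReal) ≤ dimH (jointLevelSet b d P) := by
  let IsTypical (e : ℕ → ℕ) : Prop := (∀ i, 0 < uniformTail P (m i) (b i) (e i)) ∧
    ∀ n j, HasFrequency (fun i => (b i, e i)) (n, j) (d n * P n j)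
  have htypical : ∀ᵐ e ∂digitMeasure hb hP m, ∀ᶠ N in atTop, IsTypical e ∧
      ∏ i ∈ range (N + 1), uniformTail P (m i) (b i) (e i) ≤
        (baseProd b N : ℝ) ^ (-(s : ℝ)) / b N := by
    filter_upwards [ae_digitMeasure_pos hb hP m, ae_digitMeasure_hasFrequency hb hfreq hP hm]
      with e hpos hpair
    filter_upwards [h e hpos hpair] with N hN
    exact ⟨⟨hpos, hpair⟩, prod_le_rpow_div_of_sum_log_le hb hpos hN⟩
  obtain ⟨N₀, hN₀⟩ := exists_measure_ne_zero_of_ae_eventually htypical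
  refine (le_dimH_of_cylinder_le (N₀ := N₀) hb hN₀ (fun e he i => ?_) hs fun e he N hN => ?_).trans
    (dimH_mono ?_)
  · exact lt_of_entry_pos (uniformTail_mem_stochMatrices hP (m i)) (hb i) ((he N₀ le_rfl).1.1 i)
  · simp only [rowLaw_toMeasure_singleton]
    rw [← ENNReal.ofReal_prod_of_nonneg fun i _ => ((he N hN).1.1 i).le]
    exact ENNReal.ofReal_le_ofReal (he N hN).2
  · rintro x ⟨hx, hxG⟩
    refine ⟨hx, fun k _ j _ => ?_⟩
    simpa only [HasFrequency, ← jointCount_eq_occurrences] using (hxG N₀ le_rfl).1.2 k j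

end DigitMeasure

section Dimension

variable {b : ℕ → ℕ} {d α : ℕ → ℝ} {P : ℕ → ℕ → ℝ}

theorem eventually_le_mul_of_tendsto_div {f : ℕ → ℝ} {L κ : ℝ}
    (hf : Tendsto (fun N : ℕ => f N / N) atTop (𝓝 L)) (hκ : L < κ) :
    ∀ᶠ N : ℕ in atTop, f N ≤ κ * N := by
  filter_upwards [hf.eventually_le_const hκ, eventually_gt_atTop 0] with N hN hN_pos
  rwa [div_le_iff₀ (by positivity)] at hN

theorem eventually_mul_le_of_tendsto_div {f : ℕ → ℝ} {L κ : ℝ}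
    (hf : Tendsto (fun N : ℕ => f N / N) atTop (𝓝 L)) (hκ : κ < L) :
    ∀ᶠ N : ℕ in atTop, κ * N ≤ f N := by
  filter_upwards [hf.eventually_const_le hκ, eventually_gt_atTop 0] with N hN hN_pos
  rwa [le_div_iff₀ (by positivity)] at hN

theorem mul_log_two_le_log_baseProd (hb : ∀ i, 2 ≤ b i) (N : ℕ) :
    N * Real.log 2 ≤ Real.log (baseProd b N) := by
  rw [← Real.log_pow]
  exact Real.log_le_log (by positivity) (mod_cast two_pow_le_baseProd hb N)

theorem tendsto_average_log_base (hfreq : IsBaseFrequency b d) (K : ℕ) :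
    Tendsto (fun N : ℕ => (∑ i ∈ range N, if b i < K then Real.log (b i) else 0) / (N : ℝ)) atTop
      (𝓝 (∑ n ∈ range K, d n * Real.log n)) := by
  simpa only [Finset.mem_range] using
    tendsto_average_of_hasFrequency (fun n (_ : n ∈ range K) => hfreq n) fun n => Real.log n

theorem tendsto_average_log_entry {e : ℕ → ℕ} (he : ∀ i, e i < b i)
    (hpair : ∀ n j, HasFrequency (fun i => (b i, e i)) (n, j) (d n * P n j)) (K : ℕ) :
    Tendsto (fun N : ℕ => (∑ i ∈ range N, if b i < K then Real.log (P (b i) (e i)) else 0) /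
      (N : ℝ)) atTop (𝓝 (-∑ n ∈ range K, d n * rowEntropy P n)) := by
  let pairs : Finset (ℕ × ℕ) := (range K ×ˢ range K).filter fun p => p.2 < p.1
  have hmem (i : ℕ) : (b i, e i) ∈ pairs ↔ b i < K := by
    simp only [pairs, Finset.mem_filter, Finset.mem_product, Finset.mem_range]
    have := he i
    omega
  have hsum : ∑ p ∈ pairs, d p.1 * P p.1 p.2 * Real.log (P p.1 p.2) =
      -∑ n ∈ range K, d n * rowEntropy P n := by
    rw [Finset.sum_filter, Finset.sum_product, ← Finset.sum_neg_distrib]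
    refine Finset.sum_congr rfl fun n hn => ?_
    have hrow : (range K).filter (fun j => j < n) = range n := by
      ext j
      simp only [Finset.mem_filter, Finset.mem_range] at hn ⊢
      omega
    rw [← Finset.sum_filter, hrow, rowEntropy, Finset.mul_sum, ← Finset.sum_neg_distrib]
    exact Finset.sum_congr rfl fun j _ => by rw [Real.negMulLog]; ring
  have hlim := tendsto_average_of_hasFrequency (s := pairs) (u := fun i => (b i, e i))
    (θ := fun p => d p.1 * P p.1 p.2) (fun p _ => hpair p.1 p.2) fun p => Real.log (P p.1 p.2)
  simpa only [hmem, hsum] using hlim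

theorem summable_mul_log_of_frequently (hb : ∀ i, 2 ≤ b i) (hfreq : IsBaseFrequency b d) {C : ℝ}
    (hC : ∃ᶠ N : ℕ in atTop, Real.log (baseProd b N) / N ≤ C) :
    Summable fun n : ℕ => d n * Real.log n := by
  refine summable_of_sum_range_le (c := C)
    (fun n => mul_nonneg (HasFrequency.nonneg (hfreq n)) (Real.log_natCast_nonneg n)) fun K => ?_
  refine le_of_tendsto_of_frequently (tendsto_average_log_base hfreq K) (hC.mono fun N hN => ?_)
  refine le_trans ?_ hN
  rw [log_baseProd hb]
  gcongr with i
  split_ifs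
  exacts [le_rfl, Real.log_natCast_nonneg _]

theorem one_le_dimH_jointLevelSet (hb : ∀ i, 2 ≤ b i) (hfreq : IsBaseFrequency b d)
    (hP : P ∈ stochMatrices)
    (hlim : Tendsto (fun N : ℕ => Real.log (baseProd b N) / N) atTop atTop) :
    1 ≤ dimH (jointLevelSet b d P) := by
  refine ENNReal.le_of_forall_nnreal_lt fun s hs => ?_
  have hs1 : (s : ℝ) < 1 := mod_cast hs
  have hlog_small (k : ℕ) :
      ∀ᶠ N : ℕ in atTop, (N + 1) * Real.log k ≤ (1 - s) * Real.log (baseProd b N) := by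
    filter_upwards [hlim.eventually_ge_atTop (2 * Real.log k / (1 - s)), eventually_ge_atTop 1]
      with N hN hN_one
    have hN_one : (1 : ℝ) ≤ N := mod_cast hN_one
    rw [div_le_div_iff₀ (sub_pos.2 hs1) (by linarith)] at hN
    nlinarith [Real.log_natCast_nonneg k]
  obtain ⟨m, hm_mono, hm, hm_log⟩ := exists_monotone_tendsto_atTop_of_forall_eventually hlog_small
  refine le_dimH_jointLevelSet hb hfreq hP hm (mod_cast hs1.le) fun e hpos _ => ?_
  filter_upwards [hm_log] with N hN
  have hterm (i : ℕ) (hi : i ∈ range (N + 1)) :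
      Real.log (b i) + Real.log (uniformTail P (m i) (b i) (e i)) ≤ Real.log (m N) := by
    refine (log_add_log_uniformTail_le hP (hb i) (Nat.zero_le _) (hpos i)).trans ?_
    rw [if_neg (Nat.not_lt_zero _), zero_add]
    split_ifs with hbm
    · exact Real.log_le_log (base_pos hb i)
        (mod_cast hbm.trans (hm_mono (Finset.mem_range_succ_iff.1 hi)))
    · exact Real.log_natCast_nonneg _
  refine (Finset.sum_le_card_nsmul _ _ _ hterm).trans ?_
  rwa [Finset.card_range, nsmul_eq_mul, Nat.cast_succ]

theorem exists_sum_log_add_log_uniformTail_le (hb : ∀ i, 2 ≤ b i) (hfreq : IsBaseFrequency b d)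
    (hd : IsBaseDistribution d) (hP : P ∈ stochMatrices)
    (hlog : Summable fun n : ℕ => d n * Real.log n) {κ : ℝ}
    (hκ : ∑' n : ℕ, d n * Real.log n - ∑' n, d n * rowEntropy P n < κ) :
    ∃ m : ℕ → ℕ, Tendsto m atTop atTop ∧
      ∀ e : ℕ → ℕ, (∀ i, 0 < uniformTail P (m i) (b i) (e i)) →
        (∀ n j, HasFrequency (fun i => (b i, e i)) (n, j) (d n * P n j)) →
        ∀ᶠ N in atTop, ∑ i ∈ range N,
          (Real.log (b i) + Real.log (uniformTail P (m i) (b i) (e i))) ≤ κ * N := by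
  obtain ⟨K, hK⟩ := ((summable_mul_rowEntropy hd hP hlog).hasSum.tendsto_sum_nat.eventually
    (lt_mem_nhds (sub_lt_comm.1 hκ))).exists
  obtain ⟨H, hH, hHκ⟩ := exists_between (sub_lt_iff_lt_add'.1 hK)
  have hlog_small (k : ℕ) :
      ∀ᶠ N : ℕ in atTop, ∑ i ∈ range N, (if b i < k + K + 1 then Real.log (b i) else 0) ≤ H * N :=
    eventually_le_mul_of_tendsto_div (tendsto_average_log_base hfreq _)
      ((hlog.sum_le_tsum _ fun n _ => mul_nonneg (hd.nonneg n)
        (Real.log_natCast_nonneg n)).trans_lt hH)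
  obtain ⟨m, hm_mono, hm, hm_log⟩ := exists_monotone_tendsto_atTop_of_forall_eventually hlog_small
  refine ⟨fun i => m i + K, tendsto_atTop_mono (fun i => Nat.le_add_right (m i) K) hm,
    fun e hpos hpair => ?_⟩
  have he (i : ℕ) : e i < b i :=
    lt_of_entry_pos (uniformTail_mem_stochMatrices hP (m i + K)) (hb i) (hpos i)
  filter_upwards [hm_log, eventually_le_mul_of_tendsto_div (tendsto_average_log_entry he hpair K)
    (by linarith : -∑ n ∈ range K, d n * rowEntropy P n < κ - H)] with N hN_base hN_entry
  have hterm (i : ℕ) (hi : i ∈ range N) :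
      Real.log (b i) + Real.log (uniformTail P (m i + K) (b i) (e i)) ≤
        (if b i < K then Real.log (P (b i) (e i)) else 0) +
          if b i < m N + K + 1 then Real.log (b i) else 0 := by
    refine (log_add_log_uniformTail_le hP (hb i) (Nat.le_add_left K (m i)) (hpos i)).trans ?_
    have hmi := hm_mono (Finset.mem_range.1 hi).le
    have hlog_nonneg := Real.log_natCast_nonneg (b i)
    refine add_le_add le_rfl ?_
    split_ifs <;> first | omega | linarith
  calc _ ≤ _ := Finset.sum_le_sum hterm
    _ ≤ (κ - H) * N + H * N := by
      rw [Finset.sum_add_distrib]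
      exact add_le_add hN_entry hN_base
    _ = κ * N := by ring

theorem le_dimH_jointLevelSet_of_lt (hb : ∀ i, 2 ≤ b i) (hfreq : IsBaseFrequency b d)
    (hd : IsBaseDistribution d) (hP : P ∈ stochMatrices)
    (hlog : Summable fun n : ℕ => d n * Real.log n) {κ : ℝ}
    (hκ : ∑' n : ℕ, d n * Real.log n - ∑' n, d n * rowEntropy P n < κ) {s : NNReal} (hs : s ≤ 1)
    (hκs : ∀ᶠ N : ℕ in atTop, κ * N ≤ (1 - s) * Real.log (baseProd b N)) :
    (s : ENNReal) ≤ dimH (jointLevelSet b d P) := by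
  obtain ⟨κ', hκ', hκκ'⟩ := exists_between hκ
  obtain ⟨m, hm, hsum⟩ := exists_sum_log_add_log_uniformTail_le hb hfreq hd hP hlog hκ'
  refine le_dimH_jointLevelSet hb hfreq hP hm hs fun e hpos hpair => ?_
  filter_upwards [(tendsto_add_atTop_nat 1).eventually (hsum e hpos hpair), hκs,
    (tendsto_natCast_atTop_atTop.const_mul_atTop (sub_pos.2 hκκ')).eventually_ge_atTop κ']
    with N hN hNs hN_large
  push_cast at hN
  linarith

theorem dimH_levelSet_le_dimH_jointLevelSet (hb : ∀ i, 2 ≤ b i) (hfreq : IsBaseFrequency b d)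
    (hd : IsBaseDistribution d) (hα : IsStochastic α) (hne : (admissible d α).Nonempty) :
    dimH (levelSet b α) ≤ dimH (jointLevelSet b d (optMatrix d α)) := by
  have hopt := optMatrix_mem_stochMatrices hα.1 hd hne
  have hdim_le_one : dimH (levelSet b α) ≤ 1 :=
    Real.dimH_univ ▸ dimH_mono (Set.subset_univ _)
  by_cases hlim : Tendsto (fun N : ℕ => Real.log (baseProd b N) / N) atTop atTop
  · exact hdim_le_one.trans (one_le_dimH_jointLevelSet hb hfreq hopt hlim)
  obtain ⟨C, hC⟩ := not_forall.1 (mt tendsto_atTop.2 hlim)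
  have hlog := summable_mul_log_of_frequently hb hfreq
    ((not_eventually.1 hC).mono fun N hN => (not_le.1 hN).le)
  refine ENNReal.le_of_forall_nnreal_lt fun s hs => ?_
  obtain ⟨s', hss', hs'⟩ := ENNReal.lt_iff_exists_nnreal_btwn.1 hs
  have hgap : (0 : ℝ) < s' - s := sub_pos.2 (mod_cast hss')
  set D := ∑' n : ℕ, d n * Real.log n - ∑' n, d n * rowEntropy (optMatrix d α) n
  set η := (s' - s) * Real.log 2 / 3 with hη
  have hη_pos : 0 < η := div_pos (mul_pos hgap (Real.log_pos one_lt_two)) three_pos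
  have hs'_lower : ∀ᶠ N : ℕ in atTop, (D - η) * N < (1 - s') * Real.log (baseProd b N) := by
    by_contra h
    refine hs'.not_ge (dimH_levelSet_le hb hfreq hd hα hne hlog (sub_lt_self D hη_pos) ?_)
    exact (not_eventually.1 h).mono fun N hN => not_lt.1 hN
  refine le_dimH_jointLevelSet_of_lt hb hfreq hd hopt hlog (lt_add_of_pos_right D hη_pos)
    (mod_cast hs.le.trans hdim_le_one) ?_
  filter_upwards [hs'_lower] with N hN
  have hlog_gap := mul_le_mul_of_nonneg_left (mul_log_two_le_log_baseProd hb N) hgap.le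
  have hη_two : (s' - s) * Real.log 2 * N = 3 * (η * N) := by rw [hη]; ring
  nlinarith [mul_nonneg hη_pos.le N.cast_nonneg (α := ℝ)]

section MeanLog

variable (hb : ∀ i, 2 ≤ b i) (hfreq : IsBaseFrequency b d) (hd : IsBaseDistribution d)
  (hlog : Summable fun n : ℕ => d n * Real.log n)
  (hmean : Tendsto (fun N : ℕ => Real.log (baseProd b N) / N) atTop
    (𝓝 (∑' n : ℕ, d n * Real.log n)))

include hb hfreq hd hlog hmean

theorem entropyQuotient_le_dimH_jointLevelSet (hP : P ∈ stochMatrices) :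
    ENNReal.ofReal (entropyQuotient d P) ≤ dimH (jointLevelSet b d P) := by
  refine ENNReal.le_of_forall_nnreal_lt fun s hs => ?_
  have hlog_pos := tsum_mul_log_pos hd hlog
  have hentropy_le := (summable_mul_rowEntropy hd hP hlog).tsum_le_tsum
    (mul_rowEntropy_le_mul_log hd hP) hlog
  have hs_lt := (ENNReal.lt_ofReal_iff_toReal_lt ENNReal.coe_ne_top).1 hs
  rw [entropyQuotient_eq hd, ENNReal.coe_toReal, lt_div_iff₀ hlog_pos] at hs_lt
  have hs1 : (s : ℝ) < 1 := by nlinarith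
  obtain ⟨κ, hκ, hκs⟩ := exists_between (show ∑' n : ℕ, d n * Real.log n -
    ∑' n, d n * rowEntropy P n < (1 - s) * ∑' n : ℕ, d n * Real.log n by linarith)
  refine le_dimH_jointLevelSet_of_lt hb hfreq hd hP hlog hκ (mod_cast hs1.le) ?_
  exact eventually_mul_le_of_tendsto_div
    ((hmean.const_mul (1 - s : ℝ)).congr fun N => (mul_div_assoc _ _ _).symm) hκs

theorem dimH_levelSet_le_entropyQuotient (hα : IsStochastic α)
    (hne : (admissible d α).Nonempty) :
    dimH (levelSet b α) ≤ ENNReal.ofReal (entropyQuotient d (optMatrix d α)) := by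
  refine le_of_not_gt fun hlt => ?_
  obtain ⟨s, hs, hs_dim⟩ := ENNReal.lt_iff_exists_nnreal_btwn.1 hlt
  have hs_gt := (ENNReal.ofReal_lt_ofReal_iff'.1 (hs.trans_eq ENNReal.ofReal_coe_nnreal.symm)).1
  rw [entropyQuotient_eq hd, div_lt_iff₀ (tsum_mul_log_pos hd hlog)] at hs_gt
  obtain ⟨κ, hκs, hκ⟩ := exists_between (show (1 - s) * ∑' n : ℕ, d n * Real.log n <
    ∑' n : ℕ, d n * Real.log n - ∑' n, d n * rowEntropy (optMatrix d α) n by linarith)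
  refine hs_dim.not_ge (dimH_levelSet_le hb hfreq hd hα hne hlog hκ (Eventually.frequently ?_))
  exact eventually_le_mul_of_tendsto_div
    ((hmean.const_mul (1 - s : ℝ)).congr fun N => (mul_div_assoc _ _ _).symm) hκs

theorem dimH_levelSet_eq_entropyQuotient (hα : IsStochastic α)
    (hne : (admissible d α).Nonempty) :
    dimH (levelSet b α) = ENNReal.ofReal (entropyQuotient d (optMatrix d α)) := by
  have hopt := optMatrix_mem_admissible hα hd hne
  exact (dimH_levelSet_le_entropyQuotient hb hfreq hd hlog hmean hα hne).antisymm
    ((entropyQuotient_le_dimH_jointLevelSet hb hfreq hd hlog hmean hopt.1).trans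
      (dimH_mono (jointLevelSet_subset_levelSet hb hfreq hd.hasSum hopt)))

end MeanLog

end Dimension

end CantorSeries

theorem mainTheorem2 (b : ℕ → ℕ) (hb : ∀ i, 2 ≤ b i)
    (d : ℕ → ℝ) (hd : CantorSeries.IsBaseFrequency b d) (hd1 : HasSum d 1)
    (α : ℕ → ℝ) (hα : CantorSeries.IsStochastic α)
    (hne : (CantorSeries.admissible d α).Nonempty) :
    -- the matrix is admissible, and its entries are `r_n t_j`
    CantorSeries.optMatrix d α ∈ CantorSeries.admissible d α ∧
    (∀ n j, CantorSeries.jMin α ≤ j → j < n → CantorSeries.massA d α n ≠ 0 →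
      ∏ k ∈ Finset.Icc (CantorSeries.jMin α + 1) j, CantorSeries.factor d α k ≠ 0 →
      CantorSeries.optMatrix d α n j = CantorSeries.rSeq d α n * CantorSeries.tSeq d α j) ∧
    -- rows that are not given by the formula belong to bases of frequency zero
    (∀ n, ¬ (CantorSeries.jMin α < n ∧ CantorSeries.massA d α n ≠ 0) → d n = 0) ∧
    -- inclusion and equality of dimensions
    CantorSeries.jointLevelSet b d (CantorSeries.optMatrix d α) ⊆ CantorSeries.levelSet b α ∧
    dimH (CantorSeries.jointLevelSet b d (CantorSeries.optMatrix d α)) =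
      dimH (CantorSeries.levelSet b α) ∧
    -- the supremum of the dimensions is the dimension of the level set and is attained
    dimH (CantorSeries.levelSet b α) =
      ⨆ P ∈ CantorSeries.admissible d α, dimH (CantorSeries.jointLevelSet b d P) ∧
    IsGreatest ((fun P => dimH (CantorSeries.jointLevelSet b d P)) ''
        CantorSeries.admissible d α)
      (dimH (CantorSeries.jointLevelSet b d (CantorSeries.optMatrix d α))) ∧
    -- the supremum of the entropy quotients is attained, and equals the dimension
    (Summable (fun n : ℕ => d n * Real.log n) →
      IsGreatest (CantorSeries.entropyQuotient d '' CantorSeries.admissible d α)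
        (CantorSeries.entropyQuotient d (CantorSeries.optMatrix d α)) ∧
      (Filter.Tendsto (fun N : ℕ => (∑ i ∈ Finset.range N, Real.log (b i)) / (N : ℝ))
          Filter.atTop (nhds (∑' n : ℕ, d n * Real.log n)) →
        dimH (CantorSeries.levelSet b α) =
          ENNReal.ofReal (CantorSeries.entropyQuotient d (CantorSeries.optMatrix d α)))) := by
  have hdist := hd.isBaseDistribution hb hd1
  have hadm := CantorSeries.optMatrix_mem_admissible hα hdist hne
  have hsub (P) (hP : P ∈ CantorSeries.admissible d α) :
      CantorSeries.jointLevelSet b d P ⊆ CantorSeries.levelSet b α :=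
    CantorSeries.jointLevelSet_subset_levelSet hb hd hd1 hP
  have hdim : dimH (CantorSeries.jointLevelSet b d (CantorSeries.optMatrix d α)) =
      dimH (CantorSeries.levelSet b α) :=
    (dimH_mono (hsub _ hadm)).antisymm
      (CantorSeries.dimH_levelSet_le_dimH_jointLevelSet hb hd hdist hα hne)
  have hgreatest : IsGreatest ((fun P => dimH (CantorSeries.jointLevelSet b d P)) ''
      CantorSeries.admissible d α) (dimH (CantorSeries.levelSet b α)) :=
    ⟨⟨_, hadm, hdim⟩, Set.forall_mem_image.2 fun P hP => dimH_mono (hsub P hP)⟩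
  refine ⟨hadm, fun n j => CantorSeries.optMatrix_eq_mul, fun n hn => ?_, hsub _ hadm, hdim,
    by rw [← sSup_image, hgreatest.isLUB.sSup_eq], hdim ▸ hgreatest, fun hlog =>
      ⟨CantorSeries.isGreatest_entropyQuotient hα hdist hne hlog, fun hmean => ?_⟩⟩
  · rcases not_and_or.1 hn with hn | hn
    · exact CantorSeries.eq_zero_of_le_jMin hdist hne (not_lt.1 hn)
    · exact CantorSeries.eq_zero_of_massA_eq_zero hdist hne (not_not.1 hn)
  · simp_rw [← CantorSeries.log_baseProd hb] at hmean
    exact CantorSeries.dimH_levelSet_eq_entropyQuotient hb hd hdist hlog hmean hα hne
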